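/- Let $N\ge 3$, $2^*=\frac{2N}{N-2}$, $p\in(2,2^*)$, and let $g:\mathbb R\to\mathbb R$ satisfy: (G1) $g$ is continuous; (G2) $-\infty<\liminf_{t\to0}\frac{g(t)}{t}\le\limsup_{t\to0}\frac{g(t)}{t}=-\ell<0$ for some $\ell>0$; (G3) $\lim_{|t|\to\infty}\frac{g(t)}{|t|^{p-1}}=0$, and $\lim_{|t|\to\infty}g(t)t$ exists in $[-\infty,+\infty]$ and is $\ge 0$. Let $s\in(0,1)$ be such that $p<\frac{2N}{N-2s}$, and let $u:\mathbb R^N\to\mathbb R$ belong to $H^s(\mathbb R^N)$, that is, $u\in L^2(\mathbb R^N)$ and $\int_{\mathbb R^N}\int_{\mathbb R^N}\frac{|u(x)-u(y)|^2}{|x-y|^{N+2s}}\,dx\,dy<\infty$. Suppose that $-\Delta u=g(u)$ in $\mathcal D'(\mathbb R^N)$, that is, $u,g(u)\in L^1_{\mathrm{loc}}(\mathbb R^N)$ and $-\int_{\mathbb R^N}u\,\Delta\varphi\,dx=\int_{\mathbb R^N}g(u)\varphi\,dx$ for all $\varphi\in C_0^\infty(\mathbb R^N)$. Then $u\in H^1(\mathbb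 R^N)$, and $u$ is a weak solution of $-\Delta u=g(u)$ on $\mathbb R^N$: for every $v\in H^1(\mathbb R^N)$ (in particular for every $v\in C_0^\infty(\mathbb R^N)$), the function $g(u)v$ is integrable and $\int_{\mathbb R^N}\nabla u\cdot\nabla v\,dx=\int_{\mathbb R^N}g(u)v\,dx$. -/

import Mathlib

open MeasureTheory Filter Topology Laplacian
open scoped ContDiff

noncomputable section

/-- Membership of a real function on `ℝᴺ` in the fractional Sobolev space `Hˢ(ℝᴺ)`, `0 < s < 1`:
`u ∈ L²` and the Gagliardo seminorm
`∬ |u x - u y|² / |x - y|^(N + 2 s) dx dy` is finite. -/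
def MemHs {N : ℕ} (s : ℝ) (u : EuclideanSpace ℝ (Fin N) → ℝ) : Prop :=
  MemLp u 2 volume ∧
    ∫⁻ x, ∫⁻ y, ENNReal.ofReal (|u x - u y| ^ 2 / ‖x - y‖ ^ ((N : ℝ) + 2 * s)) < ⊤

/-- `G` is the weak (distributional) gradient of `u` on `ℝᴺ`; test functions are the smooth
compactly supported functions. -/
def HasWeakGradient {N : ℕ} (u : EuclideanSpace ℝ (Fin N) → ℝ)
    (G : EuclideanSpace ℝ (Fin N) → EuclideanSpace ℝ (Fin N)) : Prop :=
  LocallyIntegrable u volume ∧ LocallyIntegrable G volume ∧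
    ∀ φ : EuclideanSpace ℝ (Fin N) → ℝ, ContDiff ℝ ∞ φ → HasCompactSupport φ →
      ∀ i : Fin N,
        ∫ x, u x * fderiv ℝ φ x (EuclideanSpace.single i 1) = -∫ x, G x i * φ x

/-- `u ∈ H¹(ℝᴺ)` with weak gradient `∇u = G`. -/
def MemH1With {N : ℕ} (u : EuclideanSpace ℝ (Fin N) → ℝ)
    (G : EuclideanSpace ℝ (Fin N) → EuclideanSpace ℝ (Fin N)) : Prop :=
  MemLp u 2 volume ∧ MemLp G 2 volume ∧ HasWeakGradient u G

/-- `u ∈ H¹(ℝᴺ)`. -/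
def MemH1 {N : ℕ} (u : EuclideanSpace ℝ (Fin N) → ℝ) : Prop :=
  ∃ G, MemH1With u G

/-- `-Δ u = g(u)` in `𝓓'(ℝᴺ)`. Both `u` and `g ∘ u` are locally integrable, so that the two sides
are distributions, and they agree on every test function. -/
def IsDistribSolution {N : ℕ} (g : ℝ → ℝ) (u : EuclideanSpace ℝ (Fin N) → ℝ) : Prop :=
  LocallyIntegrable u volume ∧ LocallyIntegrable (fun x => g (u x)) volume ∧
    ∀ φ : EuclideanSpace ℝ (Fin N) → ℝ, ContDiff ℝ ∞ φ → HasCompactSupport φ →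
      -∫ x, u x * Δ φ x = ∫ x, g (u x) * φ x

/-- `u` is a weak solution of `-Δ u = g(u)` on `ℝᴺ`: `u ∈ H¹(ℝᴺ)` and
`∫ ∇u · ∇v = ∫ g(u) v` for every `v ∈ H¹(ℝᴺ)`, in particular for every `v` smooth with compact
support; the right-hand integral is required to converge absolutely. (Weak gradients are unique
almost everywhere, so it does not matter which one is taken.) -/
def IsWeakSolution {N : ℕ} (g : ℝ → ℝ) (u : EuclideanSpace ℝ (Fin N) → ℝ) : Prop :=
  ∃ G, MemH1With u G ∧ ∀ v V, MemH1With v V →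
    Integrable (fun x => g (u x) * v x) volume ∧
      ∫ x, inner ℝ (G x) (V x) = ∫ x, g (u x) * v x

end

/-! Formally, multiplying the equation by `u` gives `∫ |∇u|² = ∫ g(u) u`, so `u ∈ H¹` as soon as the
right side is finite. The hypotheses on `g` give `|g t| ≤ C (|t| + |t|^(p-1))`, hence `g(u) ∈ L² +
Lᵖ'` once `u ∈ L² ∩ Lᵖ`, and Hölder bounds `∫ g(u) u`. That `u ∈ Lᵖ` is the subcritical embedding of
`Hˢ` (`MemHs.memLp`), obtained by iterating a pointwise bound on `u` by its Gagliardo integral.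

The formal computation is made rigorous by mollification. Since the Laplacian is linear, `uₙ = ρₙ *
u` solves `-Δ uₙ = ρₙ * g(u)` classically. The energy bound `eLpNorm_pd_le`, which presupposes
nothing about `∇w`, controls the gradient of a smooth `w` by `w Δw`. Applied to `uₙ - uₘ`, it shows
that `∇uₙ` is Cauchy in `L²`; the limit is the weak gradient of `u`.

For the weak formulation, `v ∈ H¹` lies in `L² ∩ Lᵖ` by the Sobolev embedding. The identity then
passes from test functions to smooth functions by cutoff, and to `v` by mollification. -/

/-! ### Growth of the nonlinearity. -/

theorem exists_forall_abs_le_mul_abs_add_rpow {g : ℝ → ℝ} {p : ℝ} (hg : Continuous g)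
    (hinf : (⊥ : EReal) < liminf (fun t : ℝ => ((g t / t : ℝ) : EReal)) (𝓝[≠] 0))
    (hsup : limsup (fun t : ℝ => ((g t / t : ℝ) : EReal)) (𝓝[≠] 0) < 0)
    (htop : Tendsto (fun t : ℝ => g t / |t| ^ (p - 1)) (cocompact ℝ) (𝓝 0)) :
    ∃ C : ℝ, 0 < C ∧ ∀ t, |g t| ≤ C * (|t| + |t| ^ (p - 1)) := by
  obtain ⟨a, ha0, ha⟩ := EReal.lt_iff_exists_real_btwn.1 hinf
  have h1 := eventually_lt_of_lt_liminf ha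
  have h2 := eventually_lt_of_limsup_lt hsup
  have h12 : ∀ᶠ t in 𝓝[≠] (0 : ℝ), |g t| ≤ |a| * |t| := by
    filter_upwards [h1, h2, self_mem_nhdsWithin] with t h1 h2 ht
    have h1' : a < g t / t := by exact_mod_cast h1
    have h2' : g t / t < 0 := by exact_mod_cast h2
    have ht' : 0 < |t| := abs_pos.2 ht
    have : |g t / t| ≤ |a| := by
      rw [abs_of_neg h2', abs_of_neg (h1'.trans h2')]; linarith
    rwa [abs_div, div_le_iff₀ ht'] at this
  have hg0 : g 0 = 0 := by
    have hA : Tendsto (fun t => |g t|) (𝓝[≠] (0 : ℝ)) (𝓝 |g 0|) :=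
      (hg.abs.tendsto 0).mono_left nhdsWithin_le_nhds
    have hB : Tendsto (fun t : ℝ => |a| * |t|) (𝓝[≠] (0 : ℝ)) (𝓝 0) := by
      have : Continuous fun t : ℝ => |a| * |t| := by fun_prop
      simpa using (this.tendsto 0).mono_left nhdsWithin_le_nhds
    have := le_of_tendsto_of_tendsto hA hB h12
    simpa using this
  have h12' : ∀ᶠ t in 𝓝 (0 : ℝ), |g t| ≤ |a| * |t| := by
    rw [eventually_nhdsWithin_iff] at h12
    filter_upwards [h12] with t ht
    by_cases h : t = 0
    · simp [h, hg0]
    · exact ht h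
  obtain ⟨δ, hδ, hδ'⟩ := Metric.eventually_nhds_iff.1 h12'
  have h3 : ∀ᶠ t in cocompact ℝ, |g t / |t| ^ (p - 1)| < 1 := by
    have := (htop.abs).eventually_lt_const (u := 1) (by simp)
    exact this
  obtain ⟨K, hK, hKg⟩ := mem_cocompact.1 h3
  obtain ⟨B, hB⟩ := hK.exists_bound_of_continuousOn hg.continuousOn
  have hpow : ∀ t : ℝ, 0 ≤ |t| ^ (p - 1) := fun t => by positivity
  have hB0 : 0 ≤ |B| := abs_nonneg B
  -- One summand per region: `|a|` for `|t| < δ`, `|B| / δ` for `t ∈ K` with `|t| ≥ δ`, and `1`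
  -- outside `K`.
  refine ⟨|a| + 1 + |B| / δ, by positivity, fun t => ?_⟩
  have hBδ : 0 ≤ |B| / δ := by positivity
  have hat := abs_nonneg t
  by_cases h1 : |t| < δ
  · have := hδ' (y := t) (by simpa using h1)
    calc |g t| ≤ |a| * |t| := this
      _ ≤ (|a| + 1 + |B| / δ) * (|t| + |t| ^ (p - 1)) := by
        gcongr
        · linarith
        · linarith [hpow t]
  · push Not at h1
    by_cases h2 : t ∈ K
    · calc |g t| ≤ |B| := (hB t h2).trans (le_abs_self B)
        _ = |B| / δ * δ := by field_simp
        _ ≤ (|a| + 1 + |B| / δ) * (|t| + |t| ^ (p - 1)) := by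
          gcongr
          · linarith [abs_nonneg a]
          · linarith [hpow t]
    · have h := hKg h2
      have hpos : 0 < |t| ^ (p - 1) := Real.rpow_pos_of_pos (hδ.trans_le h1) _
      simp only [Set.mem_ofPred_eq, abs_div, abs_of_pos hpos] at h
      rw [div_lt_one hpos] at h
      calc |g t| ≤ 1 * |t| ^ (p - 1) := by linarith
        _ ≤ (|a| + 1 + |B| / δ) * (|t| + |t| ^ (p - 1)) := by
          gcongr
          · linarith [abs_nonneg a]
          · linarith

/-! ### Subcritical embedding of `Hˢ`. -/

/-- Put `t = |u x|`. By Chebyshev, `{|u| ≥ t/2}` has measure at most a multiple of `t^(-q)`, so it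
fills at most half of a ball around `x` with `r^N` comparable to `t^(-q)`. On the rest of the ball
`|u x - u y| ≥ t/2`, which contributes at least a multiple of `t² r^(-2s)`, that is, of `t^(2 +
2sq/N)`. -/
theorem rpow_le_const_mul_lintegral_gagliardo {N : ℕ} (hN : 0 < N) {s q : ℝ} (hq : 0 < q)
    {u : EuclideanSpace ℝ (Fin N) → ℝ} (hum : AEStronglyMeasurable u volume)
    (hs : 0 < s) (hqu : ∫⁻ x, ENNReal.ofReal (|u x| ^ q) < ⊤) :
    ∃ K : ℝ, ∀ x, ENNReal.ofReal (|u x| ^ (2 + 2 * s / N * q)) ≤ ENNReal.ofReal K *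
      ∫⁻ y, ENNReal.ofReal (|u x - u y| ^ 2 / ‖x - y‖ ^ ((N : ℝ) + 2 * s)) := by
  have hN' : (0 : ℝ) < N := by exact_mod_cast hN
  -- The added `1` keeps `M` positive even when `u` vanishes almost everywhere.
  set M : ℝ := (∫⁻ x, ENNReal.ofReal (|u x| ^ q)).toReal + 1 with hM
  have hM0 : 0 < M := by positivity
  have hMu : ∫⁻ x, ENNReal.ofReal (|u x| ^ q) ≤ ENNReal.ofReal M :=
    (ENNReal.le_ofReal_iff_toReal_le hqu.ne hM0.le).2 (by simp [hM])
  set κ : ℝ := (volume (Metric.ball (0 : EuclideanSpace ℝ (Fin N)) 1)).toReal with hκ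
  have hκ0 : 0 < κ := ENNReal.toReal_pos (Metric.measure_ball_pos _ _ one_pos).ne'
    measure_ball_lt_top.ne
  have hκ' : volume (Metric.ball (0 : EuclideanSpace ℝ (Fin N)) 1) = ENNReal.ofReal κ :=
    (ENNReal.ofReal_toReal measure_ball_lt_top.ne).symm
  -- The factor `8 / κ` inverts `(1/2)² · κ/2`: the squared half height times half of the unit
  -- ball's volume. The power comes from `r^(2s) = V^(2s/N)`.
  refine ⟨8 / κ * (2 * M * 2 ^ q / κ) ^ (2 * s / N), fun x => ?_⟩
  rcases (abs_nonneg (u x)).eq_or_lt with ht | ht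
  · rw [← ht, Real.zero_rpow (by positivity)]; simp
  set t := |u x| with ht_def
  -- Chosen so that the ball's volume `κ V` is exactly twice the Chebyshev bound `M (t/2)^(-q)`.
  set A : ℝ := 2 * M * 2 ^ q / κ with hA
  have hA0 : 0 < A := by positivity
  set V : ℝ := A * t ^ (-q) with hV
  have hV0 : 0 < V := by positivity
  set r : ℝ := V ^ (1 / (N : ℝ)) with hr
  have hr0 : 0 < r := by positivity
  have hrN : r ^ (N : ℝ) = V := by rw [hr, ← Real.rpow_mul hV0.le]; field_simp; simp
  have hball : volume (Metric.ball x r) = ENNReal.ofReal (κ * V) := by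
    rw [Measure.addHaar_ball_of_pos _ _ hr0, hκ', ← ENNReal.ofReal_mul (by positivity)]
    congr 1
    rw [finrank_euclideanSpace_fin, ← Real.rpow_natCast, hrN, mul_comm]
  set S := {y | ENNReal.ofReal ((t / 2) ^ q) ≤ ENNReal.ofReal (|u y| ^ q)} with hS
  have haem : AEMeasurable (fun y => ENNReal.ofReal (|u y| ^ q)) volume :=
    ((hum.aemeasurable.norm).pow_const q).ennreal_ofReal
  have hSn : NullMeasurableSet S volume :=
    nullMeasurableSet_le aemeasurable_const haem
  have hSvol : volume S ≤ ENNReal.ofReal (κ * V / 2) := by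
    have h := (mul_meas_ge_le_lintegral₀ haem (ENNReal.ofReal ((t / 2) ^ q))).trans hMu
    rw [mul_comm, ← ENNReal.le_div_iff_mul_le (Or.inl (by simp; positivity)) (Or.inl (by simp)),
      ← ENNReal.ofReal_div_of_pos (by positivity)] at h
    refine h.trans_eq ?_
    congr 1
    rw [hV, hA, Real.div_rpow ht.le (by norm_num), Real.rpow_neg ht.le]
    field_simp
  have hE : ENNReal.ofReal (κ * V / 2) ≤ volume (Metric.ball x r \ S) := by
    refine le_trans ?_ le_measure_sdiff
    rw [hball]
    calc ENNReal.ofReal (κ * V / 2) = ENNReal.ofReal (κ * V) - ENNReal.ofReal (κ * V / 2) := by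
          rw [← ENNReal.ofReal_sub _ (by positivity)]; congr 1; ring
      _ ≤ _ := by gcongr
  have hEn : NullMeasurableSet (Metric.ball x r \ S) volume :=
    measurableSet_ball.nullMeasurableSet.diff hSn
  have hlow : ENNReal.ofReal ((t / 2) ^ 2 / r ^ ((N : ℝ) + 2 * s)) * ENNReal.ofReal (κ * V / 2) ≤
      ∫⁻ y, ENNReal.ofReal (|u x - u y| ^ 2 / ‖x - y‖ ^ ((N : ℝ) + 2 * s)) := by
    calc _ ≤ ENNReal.ofReal ((t / 2) ^ 2 / r ^ ((N : ℝ) + 2 * s)) *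
            volume (Metric.ball x r \ S) := by gcongr
      _ = ∫⁻ y, (Metric.ball x r \ S).indicator
            (fun _ => ENNReal.ofReal ((t / 2) ^ 2 / r ^ ((N : ℝ) + 2 * s))) y :=
          (lintegral_indicator_const₀ hEn _).symm
      _ ≤ _ := by
        refine lintegral_mono fun y => ?_
        by_cases hy : y ∈ Metric.ball x r \ S
        · rw [Set.indicator_of_mem hy]
          have hy1 : ‖x - y‖ < r := by simpa [dist_eq_norm, norm_sub_rev] using hy.1
          have hy2 : |u y| < t / 2 := by
            by_contra! hcon
            exact hy.2 (ENNReal.ofReal_le_ofReal (Real.rpow_le_rpow (by positivity) hcon hq.le))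
          have hne : x ≠ y := by
            rintro rfl
            linarith
          have hpos : 0 < ‖x - y‖ := norm_pos_iff.2 (sub_ne_zero.2 hne)
          have hdiff : t / 2 ≤ |u x - u y| := by
            have := abs_sub_abs_le_abs_sub (u x) (u y)
            linarith
          apply ENNReal.ofReal_le_ofReal
          gcongr
        · rw [Set.indicator_of_notMem hy]; exact zero_le
  refine le_trans (le_of_eq ?_) (mul_le_mul_right hlow _)
  rw [← ENNReal.ofReal_mul (by positivity), ← ENNReal.ofReal_mul (by positivity)]
  congr 1
  have h1 : r ^ ((N : ℝ) + 2 * s) = V * V ^ (2 * s / N) := by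
    rw [Real.rpow_add hr0, hrN, hr, ← Real.rpow_mul hV0.le]
    congr 2; field_simp
  have h2 : V ^ (2 * s / N) = A ^ (2 * s / N) * t ^ (-(2 * s / N * q)) := by
    rw [hV, Real.mul_rpow hA0.le (by positivity), ← Real.rpow_mul ht.le]
    congr 2; ring
  have h3 : t ^ (2 + 2 * s / N * q) = t ^ 2 * t ^ (2 * s / N * q) := by
    rw [Real.rpow_add ht]; norm_num
  rw [h1, h2, h3, Real.rpow_neg ht.le]
  have : 0 < t ^ (2 * s / N * q) := by positivity
  have : 0 < A ^ (2 * s / N) := by positivity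
  field_simp
  norm_num

/-- Pointwise `|u|^p ≤ |u|^a + |u|^b`, by comparing `|u|` with `1`. -/
theorem lintegral_ofReal_abs_rpow_lt_top_of_le {α : Type*} [MeasurableSpace α] {μ : Measure α}
    {u : α → ℝ} {a b p : ℝ} (ha0 : 0 < a) (ha : a ≤ p) (hb : p ≤ b)
    (hum : AEStronglyMeasurable u μ)
    (hau : ∫⁻ x, ENNReal.ofReal (|u x| ^ a) ∂μ < ⊤)
    (hbu : ∫⁻ x, ENNReal.ofReal (|u x| ^ b) ∂μ < ⊤) :
    ∫⁻ x, ENNReal.ofReal (|u x| ^ p) ∂μ < ⊤ := by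
  have haem : AEMeasurable (fun y => ENNReal.ofReal (|u y| ^ a)) μ :=
    ((hum.aemeasurable.norm).pow_const a).ennreal_ofReal
  calc ∫⁻ x, ENNReal.ofReal (|u x| ^ p) ∂μ
      ≤ ∫⁻ x, (ENNReal.ofReal (|u x| ^ a) + ENNReal.ofReal (|u x| ^ b)) ∂μ := by
        refine lintegral_mono fun x => ?_
        rw [← ENNReal.ofReal_add (by positivity) (by positivity)]
        apply ENNReal.ofReal_le_ofReal
        have h0a : 0 ≤ |u x| ^ a := by positivity
        have h0b : 0 ≤ |u x| ^ b := by positivity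
        rcases (abs_nonneg (u x)).eq_or_lt with h | h
        · rw [← h, Real.zero_rpow (by linarith)]; positivity
        rcases le_total (|u x|) 1 with h1 | h1
        · linarith [Real.rpow_le_rpow_of_exponent_ge h h1 ha]
        · linarith [Real.rpow_le_rpow_of_exponent_le h1 hb]
    _ = _ := lintegral_add_left' haem _
    _ < ⊤ := ENNReal.add_lt_top.2 ⟨hau, hbu⟩

theorem memLp_ofReal_iff_lintegral {α : Type*} [MeasurableSpace α] {μ : Measure α}
    {u : α → ℝ} {p : ℝ} (hp : 0 < p) (hum : AEStronglyMeasurable u μ) :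
    MemLp u (ENNReal.ofReal p) μ ↔ ∫⁻ x, ENNReal.ofReal (|u x| ^ p) ∂μ < ⊤ := by
  have h : ∀ x, ‖u x‖ₑ ^ p = ENNReal.ofReal (|u x| ^ p) := fun x => by
    rw [← ENNReal.ofReal_rpow_of_nonneg (abs_nonneg _) hp.le, Real.enorm_eq_ofReal_abs]
  rw [MemLp, and_iff_right hum, eLpNorm_lt_top_iff_lintegral_rpow_enorm_lt_top (by simpa using hp)
    (by simp), ENNReal.toReal_ofReal hp.le]
  simp_rw [h]

/-- Subcritical fractional Sobolev embedding. -/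
theorem MemHs.memLp {N : ℕ} (hN : 3 ≤ N) {s p : ℝ} (hs : 0 < s) (hs' : s < 1)
    (hp : 2 ≤ p) (hps : p < 2 * (N : ℝ) / ((N : ℝ) - 2 * s))
    {u : EuclideanSpace ℝ (Fin N) → ℝ} (hu : MemHs s u) : MemLp u (ENNReal.ofReal p) volume := by
  have hN' : (3 : ℝ) ≤ N := by exact_mod_cast hN
  have hum := hu.1.1
  have hu2 : ∫⁻ x, ENNReal.ofReal (|u x| ^ (2 : ℝ)) < ⊤ :=
    (memLp_ofReal_iff_lintegral two_pos hum).1 (by simpa using hu.1)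
  set a : ℝ := 2 * s / N with ha
  have ha0 : 0 < a := by positivity
  have ha1 : a < 1 := by rw [ha, div_lt_one (by positivity)]; linarith
  have h1a : 1 - a ≠ 0 := by linarith
  set L : ℝ := 2 / (1 - a) with hL
  have hL0 : 0 < L := div_pos two_pos (by linarith)
  have hpL : p < L := by
    refine hps.trans_eq ?_
    have : (N : ℝ) - 2 * s ≠ 0 := by linarith
    rw [hL, ha]; field_simp
  -- The exponents `L - L a^(k+1)` solve `q₀ = 2`, `q₍ₖ₊₁₎ = 2 + a qₖ`, the gain given by the
  -- pointwise bound. They increase to the fixed point `L = 2N/(N - 2s)`, so some iterate exceeds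
  -- `p`.
  have key : ∀ k : ℕ, ∫⁻ x, ENNReal.ofReal (|u x| ^ (L - L * a ^ (k + 1))) < ⊤ := by
    intro k
    induction k with
    | zero =>
      have : L - L * a ^ (0 + 1) = 2 := by rw [hL, zero_add, pow_one]; field_simp
      rw [this]; exact hu2
    | succ k ih =>
      have hq : 0 < L - L * a ^ (k + 1) := by
        have : a ^ (k + 1) < 1 := pow_lt_one₀ ha0.le ha1 (Nat.succ_ne_zero k)
        nlinarith
      obtain ⟨K, hK⟩ := rpow_le_const_mul_lintegral_gagliardo (by omega) hq hum hs ih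
      have he : L - L * a ^ (k + 1 + 1) = 2 + 2 * s / N * (L - L * a ^ (k + 1)) := by
        have : L * (1 - a) = 2 := by rw [hL]; field_simp
        rw [← ha, ← this]; ring
      rw [he]
      refine (lintegral_mono hK).trans_lt ?_
      rw [lintegral_const_mul' _ _ ENNReal.ofReal_ne_top]
      exact ENNReal.mul_lt_top ENNReal.ofReal_lt_top hu.2
  have hlim : Tendsto (fun k : ℕ => L - L * a ^ (k + 1)) atTop (𝓝 L) := by
    have := ((tendsto_pow_atTop_nhds_zero_of_lt_one ha0.le ha1).comp
      (tendsto_add_atTop_nat 1)).const_mul L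
    simpa using this.const_sub L
  obtain ⟨k, hk⟩ := (hlim.eventually_const_lt hpL).exists
  exact (memLp_ofReal_iff_lintegral (by linarith) hum).2
    (lintegral_ofReal_abs_rpow_lt_top_of_le two_pos hp hk.le hum hu2 (key k))

/-! ### Partial derivatives of smooth functions. -/

noncomputable section

open scoped Convolution ENNReal NNReal

/-- Partial derivative in the `i`-th coordinate direction. -/
def pd {N : ℕ} (i : Fin N) (f : EuclideanSpace ℝ (Fin N) → ℝ) (x : EuclideanSpace ℝ (Fin N)) : ℝ :=
  fderiv ℝ f x (EuclideanSpace.single i 1)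

theorem ContDiff.pd {N : ℕ} {f : EuclideanSpace ℝ (Fin N) → ℝ} (hf : ContDiff ℝ ∞ f) (i : Fin N) :
    ContDiff ℝ ∞ (pd i f) :=
  (hf.fderiv_right (m := ∞) (by simp)).clm_apply contDiff_const

theorem HasCompactSupport.pd {N : ℕ} {f : EuclideanSpace ℝ (Fin N) → ℝ} (hf : HasCompactSupport f)
    (i : Fin N) : HasCompactSupport (pd i f) :=
  hf.fderiv_apply ℝ _

theorem laplacian_eq_sum_pd {N : ℕ} {f : EuclideanSpace ℝ (Fin N) → ℝ} (hf : ContDiff ℝ ∞ f)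
    (x : EuclideanSpace ℝ (Fin N)) : Δ f x = ∑ i, pd i (pd i f) x := by
  rw [InnerProductSpace.laplacian_eq_iteratedFDeriv_orthonormalBasis f
    (EuclideanSpace.basisFun (Fin N) ℝ)]
  refine Finset.sum_congr rfl fun i _ => ?_
  have h : DifferentiableAt ℝ (fderiv ℝ f) x :=
    ((hf.fderiv_right (m := ∞) (by simp)).differentiable (by simp)) x
  rw [iteratedFDeriv_two_apply]
  unfold _root_.pd
  rw [fderiv_clm_apply h (differentiableAt_const _)]
  simp

theorem pd_sub {N : ℕ} {f g : EuclideanSpace ℝ (Fin N) → ℝ} (hf : ContDiff ℝ ∞ f)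
    (hg : ContDiff ℝ ∞ g) (i : Fin N) : pd i (f - g) = pd i f - pd i g := by
  ext x
  simp only [pd, Pi.sub_apply]
  rw [fderiv_sub (hf.differentiable (by simp) x) (hg.differentiable (by simp) x)]
  rfl

theorem pd_mul {N : ℕ} {f g : EuclideanSpace ℝ (Fin N) → ℝ} (hf : ContDiff ℝ ∞ f)
    (hg : ContDiff ℝ ∞ g) (i : Fin N) : pd i (f * g) = f * pd i g + g * pd i f := by
  ext x
  simp only [pd, Pi.add_apply, Pi.mul_apply]
  rw [fderiv_mul (hf.differentiable (by simp) x) (hg.differentiable (by simp) x)]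
  rfl

theorem pd_neg {N : ℕ} (f : EuclideanSpace ℝ (Fin N) → ℝ) (i : Fin N) :
    pd i (-f) = -pd i f := by
  ext x
  simp [pd, fderiv_neg]

theorem pd_comp_const_sub {N : ℕ} {f : EuclideanSpace ℝ (Fin N) → ℝ} (hf : ContDiff ℝ ∞ f)
    (a : EuclideanSpace ℝ (Fin N)) (i : Fin N) :
    pd i (fun t => f (a - t)) = fun t => -pd i f (a - t) := by
  ext t
  have h1 : HasFDerivAt f (fderiv ℝ f (a - t)) (a - t) :=
    (hf.differentiable (by simp) (a - t)).hasFDerivAt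
  have h2 := (h1.comp t ((hasFDerivAt_id t).const_sub a)).fderiv
  simp only [Function.comp_def] at h2
  simp [pd, h2]

theorem pd_comp_const_sub_two {N : ℕ} {f : EuclideanSpace ℝ (Fin N) → ℝ} (hf : ContDiff ℝ ∞ f)
    (a : EuclideanSpace ℝ (Fin N)) (i : Fin N) :
    pd i (pd i (fun t => f (a - t))) = fun t => pd i (pd i f) (a - t) := by
  rw [pd_comp_const_sub hf, show (fun t => -pd i f (a - t)) = -(fun t => pd i f (a - t)) from rfl,
    pd_neg, pd_comp_const_sub (hf.pd i)]
  ext t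
  simp

theorem pd_convolution {N : ℕ} {φ f : EuclideanSpace ℝ (Fin N) → ℝ} (hφ : ContDiff ℝ ∞ φ)
    (hφc : HasCompactSupport φ) (hf : LocallyIntegrable f volume) (i : Fin N) :
    pd i (φ ⋆[ContinuousLinearMap.lsmul ℝ ℝ, volume] f) =
      (pd i φ ⋆[ContinuousLinearMap.lsmul ℝ ℝ, volume] f) := by
  ext x
  have h := hφc.hasFDerivAt_convolution_right (ContinuousLinearMap.lsmul ℝ ℝ).flip hf
    (hφ.of_le (by simp)) x
  rw [convolution_flip] at h
  rw [pd, h.fderiv, convolution_precompR_apply _ hf (hφc.fderiv ℝ)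
    (hφ.continuous_fderiv (by simp)) x, convolution_flip]
  rfl

/-! ### Mollification. -/

/-- A standard mollifier, supported in the ball of radius `1 / (n + 1)`. -/
def mollifier (N n : ℕ) : ContDiffBump (0 : EuclideanSpace ℝ (Fin N)) where
  rIn := 1 / (2 * (n + 1))
  rOut := 1 / (n + 1)
  rIn_pos := by positivity
  rIn_lt_rOut := by
    apply one_div_lt_one_div_of_lt <;> linarith [Nat.cast_nonneg (α := ℝ) n]

theorem tendsto_mollifier_rOut (N : ℕ) :
    Tendsto (fun n => (mollifier N n).rOut) atTop (𝓝 0) :=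
  tendsto_one_div_add_atTop_nhds_zero_nat

/-- Convolution with the `n`-th standard mollifier. -/
def mollify {N : ℕ} (n : ℕ) (f : EuclideanSpace ℝ (Fin N) → ℝ) : EuclideanSpace ℝ (Fin N) → ℝ :=
  (mollifier N n).normed volume ⋆[ContinuousLinearMap.lsmul ℝ ℝ, volume] f

theorem mollify_apply_swap {N : ℕ} (n : ℕ) (f : EuclideanSpace ℝ (Fin N) → ℝ)
    (x : EuclideanSpace ℝ (Fin N)) :
    mollify n f x = ∫ t, (mollifier N n).normed volume (x - t) * f t :=
  convolution_lsmul_swap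

theorem convolutionExistsAt_mollifier {N : ℕ} (n : ℕ) {f : EuclideanSpace ℝ (Fin N) → ℝ}
    (hf : LocallyIntegrable f volume) (x : EuclideanSpace ℝ (Fin N)) :
    ConvolutionExistsAt ((mollifier N n).normed volume) f x (ContinuousLinearMap.lsmul ℝ ℝ) volume :=
  (mollifier N n).hasCompactSupport_normed.convolutionExists_left
    (ContinuousLinearMap.lsmul ℝ ℝ) ((mollifier N n).continuous_normed) hf x

theorem mollify_add {N : ℕ} (n : ℕ) {f g : EuclideanSpace ℝ (Fin N) → ℝ}
    (hf : LocallyIntegrable f volume) (hg : LocallyIntegrable g volume) :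
    mollify n (f + g) = mollify n f + mollify n g :=
  ConvolutionExists.distrib_add (fun x => convolutionExistsAt_mollifier n hf x)
    (fun x => convolutionExistsAt_mollifier n hg x)

theorem contDiff_mollify {N : ℕ} (n : ℕ) {f : EuclideanSpace ℝ (Fin N) → ℝ}
    (hf : LocallyIntegrable f volume) : ContDiff ℝ ∞ (mollify n f) :=
  (mollifier N n).hasCompactSupport_normed.contDiff_convolution_left _
    (mollifier N n).contDiff_normed hf

theorem hasCompactSupport_mollifier_const_sub {N : ℕ} (n : ℕ) (x : EuclideanSpace ℝ (Fin N)) :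
    HasCompactSupport (fun t => (mollifier N n).normed volume (x - t)) :=
  (mollifier N n).hasCompactSupport_normed.comp_homeomorph (Homeomorph.subLeft x)

theorem contDiff_mollifier_const_sub {N : ℕ} (n : ℕ) (x : EuclideanSpace ℝ (Fin N)) :
    ContDiff ℝ ∞ (fun t => (mollifier N n).normed volume (x - t)) :=
  (mollifier N n).contDiff_normed.comp (contDiff_const.sub contDiff_id)

/-- The derivative falls on the kernel, and `t ↦ ρₙ(x - t)` is a test function. The sign from the
reflection cancels the one in the definition of the weak gradient. -/
theorem pd_mollify {N : ℕ} {v : EuclideanSpace ℝ (Fin N) → ℝ}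
    {V : EuclideanSpace ℝ (Fin N) → EuclideanSpace ℝ (Fin N)} (hv : HasWeakGradient v V) (n : ℕ)
    (i : Fin N) : pd i (mollify n v) = mollify n (fun y => V y i) := by
  ext x
  rw [mollify, pd_convolution (mollifier N n).contDiff_normed
    (mollifier N n).hasCompactSupport_normed hv.1, convolution_lsmul_swap, mollify_apply_swap]
  have h := hv.2.2 _ (contDiff_mollifier_const_sub n x) (hasCompactSupport_mollifier_const_sub n x) i
  have h' : ∀ t, fderiv ℝ (fun t => (mollifier N n).normed volume (x - t)) t
      (EuclideanSpace.single i 1) = -pd i ((mollifier N n).normed volume) (x - t) := fun t =>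
    congrFun (pd_comp_const_sub (mollifier N n).contDiff_normed x i) t
  simp only [h', mul_neg, integral_neg, neg_inj] at h
  simpa only [smul_eq_mul, mul_comm] using h

/-- The equation is tested with `t ↦ ρₙ(x - t)`; two derivatives produce two reflection signs, which
cancel. -/
theorem sum_pd_pd_mollify {N : ℕ} {g : ℝ → ℝ} {u : EuclideanSpace ℝ (Fin N) → ℝ}
    (hu : IsDistribSolution g u) (n : ℕ) (x : EuclideanSpace ℝ (Fin N)) :
    ∑ i, pd i (pd i (mollify n u)) x = -mollify n (fun y => g (u y)) x := by
  have h1 : ∀ i, pd i (pd i (mollify n u)) x =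
      ∫ t, u t * pd i (pd i ((mollifier N n).normed volume)) (x - t) := fun i => by
    rw [mollify, pd_convolution (mollifier N n).contDiff_normed
      (mollifier N n).hasCompactSupport_normed hu.1, pd_convolution
      ((mollifier N n).contDiff_normed.pd i)
      ((mollifier N n).hasCompactSupport_normed.pd i) hu.1, convolution_lsmul_swap]
    simp only [smul_eq_mul, mul_comm]
  have h := hu.2.2 _ (contDiff_mollifier_const_sub n x) (hasCompactSupport_mollifier_const_sub n x)
  rw [mollify_apply_swap]
  simp_rw [h1, mul_comm _ (g _)]
  rw [← h, neg_neg, ← integral_finsetSum]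
  · refine integral_congr_ae (Eventually.of_forall fun t => ?_)
    simp only
    rw [laplacian_eq_sum_pd (contDiff_mollifier_const_sub n x), Finset.mul_sum]
    simp_rw [pd_comp_const_sub_two (mollifier N n).contDiff_normed]
  · intro i _
    have hc : ContDiff ℝ ∞ (pd i (pd i ((mollifier N n).normed volume))) :=
      (((mollifier N n).contDiff_normed).pd i).pd i
    have hs := (((mollifier N n).hasCompactSupport_normed (μ := volume)).pd i).pd i
    have := hu.1.integrable_smul_left_of_hasCompactSupport
      (g := fun t => pd i (pd i ((mollifier N n).normed volume)) (x - t))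
      (hc.continuous.comp (continuous_const.sub continuous_id))
      (hs.comp_homeomorph (Homeomorph.subLeft x))
    simpa [mul_comm] using this

/-- Translations form a continuous family of measure-preserving maps, and composition with such a
family is continuous in `Lᵖ` for finite `p`. -/
theorem tendsto_eLpNorm_translate_sub {N : ℕ} {f : EuclideanSpace ℝ (Fin N) → ℝ} {p : ℝ≥0∞}
    (hp : 1 ≤ p) (hp' : p ≠ ⊤) (hf : MemLp f p volume) :
    Tendsto (fun y => eLpNorm (fun x => f (x - y) - f x) p volume) (𝓝 0) (𝓝 0) := by
  have : Fact (1 ≤ p) := ⟨hp⟩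
  let τ : EuclideanSpace ℝ (Fin N) → C(EuclideanSpace ℝ (Fin N), EuclideanSpace ℝ (Fin N)) :=
    fun y => ⟨fun x => x - y, by fun_prop⟩
  have hτ : Continuous τ :=
    ContinuousMap.continuous_of_continuous_uncurry _
      (by change Continuous fun z : EuclideanSpace ℝ (Fin N) × EuclideanSpace ℝ (Fin N) => z.2 - z.1
          fun_prop)
  have hm : ∀ y, MeasurePreserving (τ y) volume volume := fun y => measurePreserving_sub_right _ y
  have h := (continuous_const (y := hf.toLp f)).compMeasurePreservingLp hτ hm hp'
  have h0 := (h.tendsto 0)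
  rw [tendsto_iff_edist_tendsto_0] at h0
  refine h0.congr fun y => ?_
  rw [Lp.toLp_compMeasurePreserving, Lp.toLp_compMeasurePreserving, Lp.edist_toLp_toLp]
  congr 1
  ext x
  simp [τ]

/-- `mollify n f x - f x` averages `f (x - t) - f x` over the probability measure `ν = ρₙ dt`.
Jensen's inequality and Tonelli reduce the `Lᵖ` norm to translates by `t` in the support of `ρₙ`.
Both the boundedness and the convergence of mollification follow. -/
theorem eLpNorm_mollify_sub_le {N : ℕ} {f : EuclideanSpace ℝ (Fin N) → ℝ} {p : ℝ≥0∞}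
    (hp : 1 ≤ p) (hp' : p ≠ ⊤) (hf : MemLp f p volume) (n : ℕ) {B : ℝ≥0∞}
    (hB : ∀ y ∈ Metric.ball 0 (mollifier N n).rOut,
      eLpNorm (fun x => f (x - y) - f x) p volume ≤ B) :
    eLpNorm (mollify n f - f) p volume ≤ B := by
  have hfl : LocallyIntegrable f volume := hf.locallyIntegrable hp
  have hp0 : p ≠ 0 := (one_pos.trans_le hp).ne'
  have hpr : 0 < p.toReal := ENNReal.toReal_pos hp0 hp'
  set ρ := (mollifier N n).normed (volume : Measure (EuclideanSpace ℝ (Fin N))) with hρ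
  have hρi : Integrable ρ volume := (mollifier N n).integrable_normed
  have hρm : Measurable fun t => ‖ρ t‖ₑ :=
    (mollifier N n).continuous_normed.measurable.enorm
  set ν := (volume : Measure (EuclideanSpace ℝ (Fin N))).withDensity (fun t => ‖ρ t‖ₑ) with hν
  have hνac : ν ≪ volume := withDensity_absolutelyContinuous _ _
  have hprob : IsProbabilityMeasure ν := by
    refine ⟨?_⟩
    rw [hν, withDensity_apply _ MeasurableSet.univ, setLIntegral_univ]
    have h1 : ∀ t, ‖ρ t‖ₑ = ENNReal.ofReal (ρ t) := fun t =>
      Real.enorm_of_nonneg ((mollifier N n).nonneg_normed t)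
    simp_rw [h1]
    rw [← ofReal_integral_eq_lintegral_ofReal hρi
      (Eventually.of_forall (mollifier N n).nonneg_normed), (mollifier N n).integral_normed]
    simp
  have hmeas2 : AEStronglyMeasurable
      (fun z : EuclideanSpace ℝ (Fin N) × EuclideanSpace ℝ (Fin N) => f (z.1 - z.2) - f z.1)
      (volume.prod volume) :=
    (hf.1.comp_quasiMeasurePreserving
      (quasiMeasurePreserving_sub_of_right_invariant volume volume)).sub hf.1.comp_fst
  have hmeas1 : ∀ x, AEStronglyMeasurable (fun t => f (x - t) - f x) ν := fun x =>
    ((hf.1.comp_quasiMeasurePreserving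
      (quasiMeasurePreserving_sub_left_of_right_invariant volume x)).sub
      aestronglyMeasurable_const).mono_ac hνac
  have hpt : ∀ x, ‖(mollify n f - f) x‖ₑ ^ p.toReal ≤ ∫⁻ t, ‖f (x - t) - f x‖ₑ ^ p.toReal ∂ν := by
    intro x
    have e1 : (mollify n f - f) x = ∫ t, ρ t * (f (x - t) - f x) := by
      have hi : Integrable (fun t => ρ t * f (x - t)) volume :=
        convolutionExistsAt_mollifier n hfl x
      simp_rw [mul_sub]
      rw [integral_sub hi (hρi.mul_const _), integral_mul_const,
        (mollifier N n).integral_normed, one_mul]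
      rfl
    have e2 : ‖(mollify n f - f) x‖ₑ ≤ eLpNorm (fun t => f (x - t) - f x) 1 ν := by
      rw [e1, eLpNorm_one_eq_lintegral_enorm, hν]
      refine (enorm_integral_le_lintegral_enorm _).trans ?_
      rw [lintegral_withDensity_eq_lintegral_mul₀' hρm.aemeasurable (hmeas1 x).enorm]
      simp [enorm_mul]
    have e3 := e2.trans (eLpNorm_le_eLpNorm_of_exponent_le hp (hmeas1 x))
    rw [eLpNorm_eq_lintegral_rpow_enorm_toReal hp0 hp'] at e3
    have := ENNReal.rpow_le_rpow e3 hpr.le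
    rwa [← ENNReal.rpow_mul, one_div, inv_mul_cancel₀ hpr.ne', ENNReal.rpow_one] at this
  have hball : ∀ᵐ t ∂ν, t ∈ Metric.ball (0 : EuclideanSpace ℝ (Fin N)) (mollifier N n).rOut := by
    rw [hν, ae_withDensity_iff hρm]
    refine Eventually.of_forall fun t ht => ?_
    rw [← (mollifier N n).support_normed_eq (μ := volume)]
    simpa using ht
  rw [eLpNorm_eq_lintegral_rpow_enorm_toReal hp0 hp', one_div, ENNReal.rpow_inv_le_iff hpr]
  calc ∫⁻ x, ‖(mollify n f - f) x‖ₑ ^ p.toReal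
      ≤ ∫⁻ x, ∫⁻ t, ‖f (x - t) - f x‖ₑ ^ p.toReal ∂ν := lintegral_mono hpt
    _ = ∫⁻ t, ∫⁻ x, ‖f (x - t) - f x‖ₑ ^ p.toReal ∂volume ∂ν := by
        refine lintegral_lintegral_swap ?_
        exact ((hmeas2.mono_ac (Measure.AbsolutelyContinuous.rfl.prod hνac)).enorm).pow_const _
    _ ≤ ∫⁻ _, B ^ p.toReal ∂ν := by
        refine lintegral_mono_ae ?_
        filter_upwards [hball] with t ht
        have := ENNReal.rpow_le_rpow (hB t ht) hpr.le
        rwa [eLpNorm_eq_lintegral_rpow_enorm_toReal hp0 hp', ← ENNReal.rpow_mul, one_div,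
          inv_mul_cancel₀ hpr.ne', ENNReal.rpow_one] at this
    _ = B ^ p.toReal := by simp

/-- The crude factor `3` is `2` from the translation differences plus `1` from `f` itself; any
constant independent of `n` serves. -/
theorem eLpNorm_mollify_le {N : ℕ} {f : EuclideanSpace ℝ (Fin N) → ℝ} {p : ℝ≥0∞}
    (hp : 1 ≤ p) (hp' : p ≠ ⊤) (hf : MemLp f p volume) (n : ℕ) :
    eLpNorm (mollify n f) p volume ≤ 3 * eLpNorm f p volume := by
  have h : eLpNorm (mollify n f - f) p volume ≤ eLpNorm f p volume + eLpNorm f p volume := by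
    refine eLpNorm_mollify_sub_le hp hp' hf n fun y _ => ?_
    have hmp := measurePreserving_sub_right (volume : Measure (EuclideanSpace ℝ (Fin N))) y
    refine (eLpNorm_sub_le (hf.1.comp_measurePreserving hmp) hf.1 hp).trans ?_
    rw [eLpNorm_comp_measurePreserving hf.1 hmp]
  have hm : AEStronglyMeasurable (mollify n f) volume :=
    (contDiff_mollify n (hf.locallyIntegrable hp)).continuous.aestronglyMeasurable
  calc eLpNorm (mollify n f) p volume = eLpNorm ((mollify n f - f) + f) p volume := by simp
    _ ≤ eLpNorm (mollify n f - f) p volume + eLpNorm f p volume :=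
        eLpNorm_add_le (hm.sub hf.1) hf.1 hp
    _ ≤ (eLpNorm f p volume + eLpNorm f p volume) + eLpNorm f p volume := by gcongr
    _ = 3 * eLpNorm f p volume := by ring

theorem memLp_mollify {N : ℕ} {f : EuclideanSpace ℝ (Fin N) → ℝ} {p : ℝ≥0∞}
    (hp : 1 ≤ p) (hp' : p ≠ ⊤) (hf : MemLp f p volume) (n : ℕ) : MemLp (mollify n f) p volume :=
  ⟨(contDiff_mollify n (hf.locallyIntegrable hp)).continuous.aestronglyMeasurable,
    (eLpNorm_mollify_le hp hp' hf n).trans_lt (ENNReal.mul_lt_top (by simp) hf.2)⟩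

theorem tendsto_eLpNorm_mollify_sub {N : ℕ} {f : EuclideanSpace ℝ (Fin N) → ℝ} {p : ℝ≥0∞}
    (hp : 1 ≤ p) (hp' : p ≠ ⊤) (hf : MemLp f p volume) :
    Tendsto (fun n => eLpNorm (mollify n f - f) p volume) atTop (𝓝 0) := by
  rw [ENNReal.tendsto_nhds_zero]
  intro ε hε
  have h := ENNReal.tendsto_nhds_zero.1 (tendsto_eLpNorm_translate_sub hp hp' hf) ε hε
  obtain ⟨δ, hδ, hδ'⟩ := Metric.eventually_nhds_iff_ball.1 h
  filter_upwards [(tendsto_mollifier_rOut N).eventually_lt_const hδ] with n hn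
  exact eLpNorm_mollify_sub_le hp hp' hf n fun y hy => hδ' y (Metric.ball_subset_ball hn.le hy)

theorem ae_tendsto_mollify {N : ℕ} {f : EuclideanSpace ℝ (Fin N) → ℝ}
    (hf : LocallyIntegrable f volume) :
    ∀ᵐ x, Tendsto (fun n => mollify n f x) atTop (𝓝 (f x)) := by
  -- `K = 2` is the fixed ratio of outer to inner radius in `mollifier`.
  refine ContDiffBump.ae_convolution_tendsto_right_of_locallyIntegrable (K := 2)
    (tendsto_mollifier_rOut N) (Eventually.of_forall fun n => ?_) hf
  simp only [mollifier]
  apply le_of_eq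
  field_simp

/-! ### Integration by parts and cutoffs. -/

theorem integral_mul_pd {N : ℕ} {w φ : EuclideanSpace ℝ (Fin N) → ℝ} (hw : ContDiff ℝ ∞ w)
    (hφ : ContDiff ℝ ∞ φ) (hφc : HasCompactSupport φ) (i : Fin N) :
    ∫ x, w x * pd i φ x = -∫ x, pd i w x * φ x := by
  refine integral_mul_fderiv_eq_neg_fderiv_mul_of_integrable ?_ ?_ ?_
    (fun x _ => hw.differentiable (by simp) x) (fun x _ => hφ.differentiable (by simp) x)
  · exact ((hw.pd i).continuous.mul hφ.continuous).integrable_of_hasCompactSupport hφc.mul_left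
  · exact (hw.continuous.mul (hφ.pd i).continuous).integrable_of_hasCompactSupport
      (hφc.pd i).mul_left
  · exact (hw.continuous.mul hφ.continuous).integrable_of_hasCompactSupport hφc.mul_left

theorem pd_comp_smul {N : ℕ} (f : EuclideanSpace ℝ (Fin N) → ℝ) (c : ℝ) (i : Fin N) :
    pd i (fun x => f (c • x)) = fun x => c * pd i f (c • x) := by
  ext x
  simp [pd, fderiv_comp_smul]

theorem pd_const_mul {N : ℕ} {f : EuclideanSpace ℝ (Fin N) → ℝ} (hf : ContDiff ℝ ∞ f) (c : ℝ)
    (i : Fin N) : pd i (fun x => c * f x) = fun x => c * pd i f x := by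
  ext x
  simp [pd, fderiv_const_mul (hf.differentiable (by simp) x)]

/-- A smooth cutoff function, equal to `1` on the ball of radius `n + 1`. -/
def cutoff (N n : ℕ) (x : EuclideanSpace ℝ (Fin N)) : ℝ :=
  (⟨1, 2, one_pos, one_lt_two⟩ : ContDiffBump (0 : EuclideanSpace ℝ (Fin N)))
    ((1 / ((n : ℝ) + 1)) • x)

theorem contDiff_cutoff (N n : ℕ) : ContDiff ℝ ∞ (cutoff N n) :=
  (ContDiffBump.contDiff _).comp (contDiff_const_smul _)

theorem hasCompactSupport_cutoff (N n : ℕ) : HasCompactSupport (cutoff N n) :=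
  (ContDiffBump.hasCompactSupport _).comp_smul (by positivity)

theorem cutoff_nonneg (N n : ℕ) (x : EuclideanSpace ℝ (Fin N)) : 0 ≤ cutoff N n x :=
  ContDiffBump.nonneg _

theorem cutoff_le_one (N n : ℕ) (x : EuclideanSpace ℝ (Fin N)) : cutoff N n x ≤ 1 :=
  ContDiffBump.le_one _

theorem tendsto_cutoff {N : ℕ} (x : EuclideanSpace ℝ (Fin N)) :
    Tendsto (fun n => cutoff N n x) atTop (𝓝 1) := by
  obtain ⟨k, hk⟩ := exists_nat_ge ‖x‖
  refine tendsto_const_nhds.congr' ?_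
  filter_upwards [eventually_ge_atTop k] with n hn
  refine (ContDiffBump.one_of_mem_closedBall _ ?_).symm
  have hn' : (k : ℝ) ≤ n := by exact_mod_cast hn
  have : 0 < (n : ℝ) + 1 := by positivity
  rw [mem_closedBall_zero_iff, norm_smul, Real.norm_of_nonneg (by positivity), one_div,
    inv_mul_le_iff₀ this]
  linarith

theorem exists_abs_pd_cutoff_le (N : ℕ) : ∃ C : ℝ, 0 ≤ C ∧ ∀ n i x,
    |pd i (cutoff N n) x| ≤ C * (1 / ((n : ℝ) + 1)) ∧
      |pd i (pd i (cutoff N n)) x| ≤ C * (1 / ((n : ℝ) + 1)) := by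
  set χ : ContDiffBump (0 : EuclideanSpace ℝ (Fin N)) := ⟨1, 2, one_pos, one_lt_two⟩ with hχ
  have hs : ContDiff ℝ ∞ χ := χ.contDiff
  have hc : HasCompactSupport χ := χ.hasCompactSupport
  have h1 : ∀ i, ∃ C, ∀ x, ‖pd i χ x‖ ≤ C := fun i =>
    (hc.pd i).exists_bound_of_continuous (hs.pd i).continuous
  have h2 : ∀ i, ∃ C, ∀ x, ‖pd i (pd i χ) x‖ ≤ C := fun i =>
    ((hc.pd i).pd i).exists_bound_of_continuous ((hs.pd i).pd i).continuous
  choose A hA using h1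
  choose B hB using h2
  have hA0 : ∀ i, 0 ≤ A i := fun i => (norm_nonneg _).trans (hA i 0)
  have hB0 : ∀ i, 0 ≤ B i := fun i => (norm_nonneg _).trans (hB i 0)
  have hAi : ∀ i, A i ≤ ∑ j, (A j + B j) := fun i =>
    (le_add_of_nonneg_right (hB0 i)).trans
      (Finset.single_le_sum (f := fun j => A j + B j) (fun j _ => add_nonneg (hA0 j) (hB0 j))
        (Finset.mem_univ i))
  have hBi : ∀ i, B i ≤ ∑ j, (A j + B j) := fun i =>
    (le_add_of_nonneg_left (hA0 i)).trans
      (Finset.single_le_sum (f := fun j => A j + B j) (fun j _ => add_nonneg (hA0 j) (hB0 j))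
        (Finset.mem_univ i))
  refine ⟨∑ j, (A j + B j), Finset.sum_nonneg fun j _ => add_nonneg (hA0 j) (hB0 j),
    fun n i x => ?_⟩
  set c : ℝ := 1 / ((n : ℝ) + 1) with hcdef
  have hc0 : 0 < c := by positivity
  have hc1 : c ≤ 1 := by
    rw [hcdef, div_le_one (by positivity)]; linarith [Nat.cast_nonneg (α := ℝ) n]
  have e1 : pd i (cutoff N n) = fun x => c * pd i χ (c • x) := pd_comp_smul χ c i
  have e2 : pd i (pd i (cutoff N n)) = fun x => c * (c * pd i (pd i χ) (c • x)) := by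
    rw [e1, pd_const_mul (f := fun x => pd i χ (c • x)) ((hs.pd i).comp (contDiff_const_smul c)),
      pd_comp_smul]
  constructor
  · rw [e1, abs_mul, abs_of_pos hc0, mul_comm]
    gcongr
    exact (hA i _).trans (hAi i)
  · rw [e2, abs_mul, abs_mul, abs_of_pos hc0]
    -- Scaling gives `c²`; one factor `c ≤ 1` is dropped so that both derivatives share one bound.
    calc c * (c * |pd i (pd i χ) (c • x)|) ≤ c * (1 * ∑ j, (A j + B j)) := by
          gcongr
          exact (hB i _).trans (hBi i)
      _ = (∑ j, (A j + B j)) * c := by ring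

/-! ### Energy estimate. -/

/-- From `½ Δ(w²) = |∇w|² + w Δw`, with both derivatives of `w²` moved onto `χ`. No gradient of `w`
is left on the right, so no integrability of `∇w` is needed. -/
theorem integral_mul_sum_pd_sq {N : ℕ} {w h χ : EuclideanSpace ℝ (Fin N) → ℝ}
    (hw : ContDiff ℝ ∞ w) (hχ : ContDiff ℝ ∞ χ) (hχc : HasCompactSupport χ)
    (hΔ : ∀ x, ∑ i, pd i (pd i w) x = -h x) :
    ∫ x, χ x * ∑ i, pd i w x ^ 2 =
      (∫ x, χ x * (w x * h x)) + 1 / 2 * ∫ x, w x ^ 2 * ∑ i, pd i (pd i χ) x := by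
  have hww : ContDiff ℝ ∞ (w * w) := hw.mul hw
  have hpp : ∀ i, pd i (pd i (w * w)) = fun x => 2 * (pd i w x ^ 2 + w x * pd i (pd i w) x) := by
    intro i
    rw [pd_mul hw hw, show w * pd i w + w * pd i w = fun x => 2 * (w * pd i w) x by
      ext x; simp; ring, pd_const_mul (f := w * pd i w) (hw.mul (hw.pd i)), pd_mul hw (hw.pd i)]
    ext x
    simp; ring
  have hint : ∀ f : EuclideanSpace ℝ (Fin N) → ℝ, Continuous f →
      Integrable (fun x => χ x * f x) volume := fun f hf =>
    (hχ.continuous.mul hf).integrable_of_hasCompactSupport hχc.mul_right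
  have h1 : ∀ i, ∫ x, w x ^ 2 * pd i (pd i χ) x =
      2 * ∫ x, χ x * (pd i w x ^ 2 + w x * pd i (pd i w) x) := by
    intro i
    have a1 := integral_mul_pd hww (hχ.pd i) (hχc.pd i) i
    have a2 := integral_mul_pd (hww.pd i) hχ hχc i
    rw [a2, neg_neg, hpp] at a1
    rw [← integral_const_mul]
    calc ∫ x, w x ^ 2 * pd i (pd i χ) x = ∫ x, (w * w) x * pd i (pd i χ) x := by
          simp only [Pi.mul_apply, pow_two]
      _ = _ := by
          rw [a1]
          refine integral_congr_ae (Eventually.of_forall fun x => ?_)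
          simp only
          ring
  have hc1 : ∀ i, Continuous (fun x => w x ^ 2 * pd i (pd i χ) x) := fun i =>
    (hw.continuous.pow 2).mul ((hχ.pd i).pd i).continuous
  have h2 : ∫ x, w x ^ 2 * ∑ i, pd i (pd i χ) x =
      2 * ∫ x, χ x * ∑ i, (pd i w x ^ 2 + w x * pd i (pd i w) x) := by
    simp_rw [Finset.mul_sum]
    rw [integral_finsetSum, integral_finsetSum, Finset.mul_sum]
    · exact Finset.sum_congr rfl fun i _ => h1 i
    · intro i _
      exact hint _ (((hw.pd i).continuous.pow 2).add
        (hw.continuous.mul ((hw.pd i).pd i).continuous))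
    · intro i _
      exact (hc1 i).integrable_of_hasCompactSupport ((hχc.pd i).pd i).mul_left
  have h3 : ∀ x, ∑ i, (pd i w x ^ 2 + w x * pd i (pd i w) x) =
      (∑ i, pd i w x ^ 2) - w x * h x := fun x => by
    rw [Finset.sum_add_distrib, ← Finset.mul_sum, hΔ]; ring
  have hh : Continuous h := by
    have : h = fun x => -∑ i, pd i (pd i w) x := by ext x; rw [hΔ, neg_neg]
    rw [this]
    exact (continuous_finsetSum _ fun i _ => ((hw.pd i).pd i).continuous).neg
  rw [h2]
  simp_rw [h3, mul_sub]
  rw [integral_sub]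
  · ring
  · exact hint _ (continuous_finsetSum _ fun i _ => (hw.pd i).continuous.pow 2)
  · exact hint _ (hw.continuous.mul hh)

/-- With `χ` the `n`-th cutoff, the error `½ ∫ w² Δχ` is at most `B / (n + 1)` because `w ∈ L²`.
Fatou's lemma then removes the cutoff. -/
theorem eLpNorm_pd_le {N : ℕ} {w h : EuclideanSpace ℝ (Fin N) → ℝ} (hw : ContDiff ℝ ∞ w)
    (hw2 : MemLp w 2 volume) (hΔ : ∀ x, ∑ i, pd i (pd i w) x = -h x)
    (hwh : Integrable (fun x => w x * h x) volume) (i : Fin N) :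
    eLpNorm (pd i w) 2 volume ≤ eLpNorm (fun x => w x * h x) 1 volume ^ (1 / 2 : ℝ) := by
  obtain ⟨C, hC0, hC⟩ := exists_abs_pd_cutoff_le N
  have hw2i : Integrable (fun x => w x ^ 2) volume := hw2.integrable_sq
  set A : ℝ := ∫ x, |w x * h x| with hA
  set B : ℝ := 1 / 2 * ∫ x, w x ^ 2 * (N * C) with hB
  have hbound : ∀ n, ∫ x, cutoff N n x * ∑ i, pd i w x ^ 2 ≤ A + B * (1 / ((n : ℝ) + 1)) := by
    intro n
    rw [integral_mul_sum_pd_sq hw (contDiff_cutoff N n) (hasCompactSupport_cutoff N n) hΔ]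
    have hc : 0 ≤ 1 / ((n : ℝ) + 1) := by positivity
    have hci : Integrable (fun x => cutoff N n x * (w x * h x)) volume := by
      refine hwh.mono ((contDiff_cutoff N n).continuous.aestronglyMeasurable.mul hwh.1)
        (Eventually.of_forall fun x => ?_)
      rw [norm_mul, Real.norm_of_nonneg (cutoff_nonneg N n x)]
      exact mul_le_of_le_one_left (norm_nonneg _) (cutoff_le_one N n x)
    refine add_le_add ?_ ?_
    · refine integral_mono hci hwh.abs fun x => ?_
      calc cutoff N n x * (w x * h x) ≤ cutoff N n x * |w x * h x| :=
            mul_le_mul_of_nonneg_left (le_abs_self _) (cutoff_nonneg N n x)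
        _ ≤ |w x * h x| := mul_le_of_le_one_left (abs_nonneg _) (cutoff_le_one N n x)
    · rw [hB, mul_assoc, ← integral_mul_const]
      gcongr ?_ * ?_
      have hsum : ∀ x, ∑ i, pd i (pd i (cutoff N n)) x ≤ N * C * (1 / ((n : ℝ) + 1)) := fun x => by
        calc ∑ i, pd i (pd i (cutoff N n)) x ≤ ∑ _i : Fin N, C * (1 / ((n : ℝ) + 1)) :=
              Finset.sum_le_sum fun i _ => (le_abs_self _).trans (hC n i x).2
          _ = N * C * (1 / ((n : ℝ) + 1)) := by simp [mul_assoc]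
      refine integral_mono ?_ ((hw2i.mul_const _).mul_const _) fun x => ?_
      · simp_rw [Finset.mul_sum]
        exact integrable_finsetSum _ fun i _ => ((hw.continuous.pow 2).mul
          (((contDiff_cutoff N n).pd i).pd i).continuous).integrable_of_hasCompactSupport
          (((hasCompactSupport_cutoff N n).pd i).pd i).mul_left
      · calc w x ^ 2 * ∑ i, pd i (pd i (cutoff N n)) x
            ≤ w x ^ 2 * (N * C * (1 / ((n : ℝ) + 1))) := by
              gcongr
              exact hsum x
          _ = w x ^ 2 * (N * C) * (1 / ((n : ℝ) + 1)) := by ring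
  have hlint : ∀ n, ∫⁻ x, ENNReal.ofReal (cutoff N n x * pd i w x ^ 2) ≤
      ENNReal.ofReal (A + B * (1 / ((n : ℝ) + 1))) := by
    intro n
    have hci : ∀ f : EuclideanSpace ℝ (Fin N) → ℝ, Continuous f →
        Integrable (fun x => cutoff N n x * f x) volume := fun f hf =>
      ((contDiff_cutoff N n).continuous.mul hf).integrable_of_hasCompactSupport
        (hasCompactSupport_cutoff N n).mul_right
    rw [← ofReal_integral_eq_lintegral_ofReal (hci (fun x => pd i w x ^ 2) ((hw.pd i).continuous.pow 2))
      (Eventually.of_forall fun x => mul_nonneg (cutoff_nonneg N n x) (sq_nonneg _))]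
    refine ENNReal.ofReal_le_ofReal (le_trans ?_ (hbound n))
    refine integral_mono (hci (fun x => pd i w x ^ 2) ((hw.pd i).continuous.pow 2))
      (hci _ (continuous_finsetSum _ fun i _ => (hw.pd i).continuous.pow 2)) fun x => ?_
    exact mul_le_mul_of_nonneg_left (Finset.single_le_sum (f := fun i => pd i w x ^ 2)
      (fun j _ => sq_nonneg _) (Finset.mem_univ i)) (cutoff_nonneg N n x)
  have hlim : Tendsto (fun n : ℕ => ENNReal.ofReal (A + B * (1 / ((n : ℝ) + 1)))) atTop
      (𝓝 (ENNReal.ofReal A)) := by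
    refine ENNReal.tendsto_ofReal ?_
    simpa using (tendsto_one_div_add_atTop_nhds_zero_nat.const_mul B).const_add A
  have hfatou : ∫⁻ x, ENNReal.ofReal (pd i w x ^ 2) ≤ ENNReal.ofReal A := by
    calc ∫⁻ x, ENNReal.ofReal (pd i w x ^ 2)
        = ∫⁻ x, liminf (fun n => ENNReal.ofReal (cutoff N n x * pd i w x ^ 2)) atTop := by
          refine lintegral_congr fun x => ?_
          refine (Tendsto.liminf_eq ?_).symm
          refine ENNReal.tendsto_ofReal ?_
          simpa using (tendsto_cutoff x).mul_const (pd i w x ^ 2)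
      _ ≤ liminf (fun n => ∫⁻ x, ENNReal.ofReal (cutoff N n x * pd i w x ^ 2)) atTop := by
          refine lintegral_liminf_le fun n => ?_
          exact ((contDiff_cutoff N n).continuous.mul
            ((hw.pd i).continuous.pow 2)).measurable.ennreal_ofReal
      _ ≤ liminf (fun n : ℕ => ENNReal.ofReal (A + B * (1 / ((n : ℝ) + 1)))) atTop :=
          liminf_le_liminf (Eventually.of_forall hlint)
      _ = ENNReal.ofReal A := hlim.liminf_eq
  rw [eLpNorm_eq_lintegral_rpow_enorm_toReal two_ne_zero ENNReal.ofNat_ne_top,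
    eLpNorm_one_eq_lintegral_enorm, ← ofReal_integral_norm_eq_lintegral_enorm hwh]
  refine ENNReal.rpow_le_rpow ?_ (by norm_num)
  refine le_trans (le_of_eq ?_) hfatou
  refine lintegral_congr fun x => ?_
  rw [Real.enorm_eq_ofReal_abs, ENNReal.ofReal_rpow_of_nonneg (abs_nonneg _) (by simp)]
  simp

/-! ### Dual pairings and `H¹` regularity. -/

theorem eLpNorm_mul_one_le {α : Type*} [MeasurableSpace α] {μ : Measure α} {p q : ℝ≥0∞}
    [ENNReal.HolderConjugate p q] {a b : α → ℝ} (ha : AEStronglyMeasurable a μ)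
    (hb : AEStronglyMeasurable b μ) :
    eLpNorm (fun x => a x * b x) 1 μ ≤ eLpNorm a p μ * eLpNorm b q μ := by
  have h := eLpNorm_smul_le_mul_eLpNorm (𝕜 := ℝ) (p := p) (q := q) (r := 1) hb ha
  exact h

theorem tendsto_integral_mul_of_tendsto_eLpNorm {α : Type*} [MeasurableSpace α] {μ : Measure α}
    {p q : ℝ≥0∞} [ENNReal.HolderConjugate p q] {a : ℕ → α → ℝ} {a' b : α → ℝ}
    (ha : ∀ n, MemLp (a n) p μ) (ha' : MemLp a' p μ) (hb : MemLp b q μ)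
    (hlim : Tendsto (fun n => eLpNorm (a n - a') p μ) atTop (𝓝 0)) :
    Tendsto (fun n => ∫ x, a n x * b x ∂μ) atTop (𝓝 (∫ x, a' x * b x ∂μ)) := by
  refine tendsto_integral_of_L1' _ (ha'.integrable_mul hb).1
    (Eventually.of_forall fun n => (ha n).integrable_mul hb) ?_
  refine tendsto_of_tendsto_of_tendsto_of_le_of_le tendsto_const_nhds
    (by simpa using ENNReal.Tendsto.mul_const hlim (Or.inr hb.2.ne)) (fun _ => zero_le) fun n => ?_
  refine le_trans (le_of_eq ?_) (eLpNorm_mul_one_le (p := p) (q := q) ((ha n).sub ha').1 hb.1)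
  congr 1
  ext x
  simp [sub_mul]

/-- A nonlinearity growing at most like `|t| + |t| ^ (p - 1)` maps `L² ∩ Lᵖ` into `L² + Lᵖ'`. -/
theorem exists_memLp_add_memLp_comp {α : Type*} [MeasurableSpace α] {μ : Measure α} {g : ℝ → ℝ}
    (hg : Continuous g) {p q C : ℝ} (hp : 2 ≤ p) (hpq : p.HolderConjugate q)
    (hgC : ∀ t, |g t| ≤ C * (|t| + |t| ^ (p - 1))) {u : α → ℝ} (hu2 : MemLp u 2 μ)
    (hup : MemLp u (ENNReal.ofReal p) μ) :
    ∃ f₁ f₂ : α → ℝ, MemLp f₁ 2 μ ∧ MemLp f₂ (ENNReal.ofReal q) μ ∧ (fun x => g (u x)) = f₁ + f₂ := by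
  have hC : 0 ≤ C := by
    have h := (abs_nonneg _).trans (hgC 1)
    simp only [abs_one, Real.one_rpow] at h
    linarith
  have hp1 : p - 1 ≠ 0 := by linarith
  -- As `p - 1 ≥ 1`, the linear term dominates on `S`, giving the `L²` piece, and the power term
  -- dominates off `S`. There `(p - 1) q = p` gives the `L^q` piece.
  set S : Set ℝ := {t | |t| ≤ 1} with hS
  have hSm : MeasurableSet S := measurableSet_le measurable_norm measurable_const
  have hm1 : AEStronglyMeasurable (fun x => S.indicator g (u x)) μ :=
    ((hg.measurable.indicator hSm).comp_aemeasurable hu2.1.aemeasurable).aestronglyMeasurable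
  have hm2 : AEStronglyMeasurable (fun x => Sᶜ.indicator g (u x)) μ :=
    ((hg.measurable.indicator hSm.compl).comp_aemeasurable
      hu2.1.aemeasurable).aestronglyMeasurable
  refine ⟨fun x => S.indicator g (u x), fun x => Sᶜ.indicator g (u x), ?_, ?_, ?_⟩
  · refine MemLp.of_le_mul (c := 2 * C) hu2 hm1 (Eventually.of_forall fun x => ?_)
    simp only [Real.norm_eq_abs]
    by_cases h : u x ∈ S
    · rw [Set.indicator_of_mem h]
      have h1 : |u x| ^ (p - 1) ≤ |u x| := by
        rcases (abs_nonneg (u x)).eq_or_lt with h0 | h0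
        · rw [← h0, Real.zero_rpow hp1]
        · simpa using Real.rpow_le_rpow_of_exponent_ge h0 h (by linarith : (1 : ℝ) ≤ p - 1)
      calc |g (u x)| ≤ C * (|u x| + |u x| ^ (p - 1)) := hgC _
        _ ≤ C * (|u x| + |u x|) := by gcongr
        _ = 2 * C * |u x| := by ring
    · rw [Set.indicator_of_notMem h, abs_zero]
      positivity
  · rw [memLp_ofReal_iff_lintegral hpq.symm.pos hm2]
    have hup' := (memLp_ofReal_iff_lintegral hpq.pos hup.1).1 hup
    calc ∫⁻ x, ENNReal.ofReal (|Sᶜ.indicator g (u x)| ^ q) ∂μ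
        ≤ ∫⁻ x, ENNReal.ofReal ((2 * C) ^ q) * ENNReal.ofReal (|u x| ^ p) ∂μ := by
          refine lintegral_mono fun x => ?_
          rw [← ENNReal.ofReal_mul (by positivity)]
          apply ENNReal.ofReal_le_ofReal
          by_cases h : u x ∈ Sᶜ
          · rw [Set.indicator_of_mem h]
            have h' : 1 < |u x| := by simpa [hS] using h
            have h1 : |u x| ≤ |u x| ^ (p - 1) := by
              simpa using Real.rpow_le_rpow_of_exponent_le h'.le (by linarith : (1 : ℝ) ≤ p - 1)
            have h2 : |g (u x)| ≤ 2 * C * |u x| ^ (p - 1) := by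
              calc |g (u x)| ≤ C * (|u x| + |u x| ^ (p - 1)) := hgC _
                _ ≤ C * (|u x| ^ (p - 1) + |u x| ^ (p - 1)) := by gcongr
                _ = 2 * C * |u x| ^ (p - 1) := by ring
            calc |g (u x)| ^ q ≤ (2 * C * |u x| ^ (p - 1)) ^ q :=
                  Real.rpow_le_rpow (abs_nonneg _) h2 hpq.symm.nonneg
              _ = (2 * C) ^ q * |u x| ^ p := by
                  rw [Real.mul_rpow (by positivity) (by positivity),
                    ← Real.rpow_mul (abs_nonneg _), hpq.sub_one_mul_conj]
          · rw [Set.indicator_of_notMem h, abs_zero, Real.zero_rpow hpq.symm.pos.ne']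
            positivity
      _ < ⊤ := by
          rw [lintegral_const_mul' _ _ ENNReal.ofReal_ne_top]
          exact ENNReal.mul_lt_top ENNReal.ofReal_lt_top hup'
  · ext x
    simp only [Pi.add_apply]
    rw [← Pi.add_apply (S.indicator g), Set.indicator_self_add_compl]

theorem exists_memLp_tendsto_eLpNorm_sub {α : Type*} [MeasurableSpace α] {μ : Measure α}
    {p : ℝ≥0∞} (hp : 1 ≤ p) {f : ℕ → α → ℝ} (hf : ∀ n, MemLp (f n) p μ)
    (hc : Tendsto (fun n : ℕ × ℕ => eLpNorm (f n.1 - f n.2) p μ) atTop (𝓝 0)) :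
    ∃ F, MemLp F p μ ∧ Tendsto (fun n => eLpNorm (f n - F) p μ) atTop (𝓝 0) := by
  have : Fact (1 ≤ p) := ⟨hp⟩
  have hcs : CauchySeq fun n => (hf n).toLp (f n) := by
    rw [Lp.cauchySeq_Lp_iff_cauchySeq_eLpNorm]
    refine hc.congr fun n => eLpNorm_congr_ae ?_
    exact ((hf n.1).coeFn_toLp.symm).sub ((hf n.2).coeFn_toLp.symm)
  obtain ⟨F, hF⟩ := cauchySeq_tendsto_of_complete hcs
  refine ⟨F, Lp.memLp F, ?_⟩
  rw [← Lp.tendsto_Lp_iff_tendsto_eLpNorm'' f hf F (Lp.memLp F), Lp.toLp_coeFn]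
  exact hF

theorem tendsto_eLpNorm_mollify_sub_mollify {N : ℕ} {f : EuclideanSpace ℝ (Fin N) → ℝ} {p : ℝ≥0∞}
    (hp : 1 ≤ p) (hp' : p ≠ ⊤) (hf : MemLp f p volume) :
    Tendsto (fun n : ℕ × ℕ => eLpNorm (mollify n.1 f - mollify n.2 f) p volume) atTop (𝓝 0) := by
  have h := tendsto_eLpNorm_mollify_sub hp hp' hf
  rw [← prod_atTop_atTop_eq]
  have h2 := (h.comp (tendsto_fst (g := (atTop : Filter ℕ)))).add
    (h.comp (tendsto_snd (f := (atTop : Filter ℕ))))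
  rw [add_zero] at h2
  refine tendsto_of_tendsto_of_tendsto_of_le_of_le tendsto_const_nhds h2 (fun _ => zero_le)
    fun n => ?_
  have hm : ∀ k, MemLp (mollify k f - f) p volume := fun k => (memLp_mollify hp hp' hf k).sub hf
  calc eLpNorm (mollify n.1 f - mollify n.2 f) p volume
      = eLpNorm ((mollify n.1 f - f) - (mollify n.2 f - f)) p volume := by simp
    _ ≤ _ := eLpNorm_sub_le (hm _).1 (hm _).1 hp

section

variable {N : ℕ} {p q : ℝ≥0∞} [ENNReal.HolderConjugate p q]

/-- The hypotheses are linear in `(w, h₁, h₂)`, so this serves both a single mollification and the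
difference of two. -/
theorem eLpNorm_pd_le_of_add {w h₁ h₂ : EuclideanSpace ℝ (Fin N) → ℝ} (hw : ContDiff ℝ ∞ w)
    (hw2 : MemLp w 2 volume) (hwp : MemLp w p volume) (h₁2 : MemLp h₁ 2 volume)
    (h₂q : MemLp h₂ q volume) (hΔ : ∀ x, ∑ i, pd i (pd i w) x = -(h₁ x + h₂ x)) (i : Fin N) :
    eLpNorm (pd i w) 2 volume ≤ (eLpNorm w 2 volume * eLpNorm h₁ 2 volume +
      eLpNorm w p volume * eLpNorm h₂ q volume) ^ (1 / 2 : ℝ) := by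
  have e : (fun x => w x * (h₁ x + h₂ x)) = (fun x => w x * h₁ x) + fun x => w x * h₂ x := by
    ext x; simp [mul_add]
  have i1 : Integrable (fun x => w x * h₁ x) volume := hw2.integrable_mul h₁2
  have i2 : Integrable (fun x => w x * h₂ x) volume := hwp.integrable_mul h₂q
  refine (eLpNorm_pd_le (h := fun x => h₁ x + h₂ x) hw hw2 hΔ (e ▸ i1.add i2) i).trans ?_
  refine ENNReal.rpow_le_rpow ?_ (by norm_num)
  rw [e]
  exact (eLpNorm_add_le i1.1 i2.1 le_rfl).trans
    (add_le_add (eLpNorm_mul_one_le hw2.1 h₁2.1) (eLpNorm_mul_one_le hwp.1 h₂q.1))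

/-- A distributional solution of `-Δ u = g(u)` with `u ∈ L² ∩ Lᵖ` and `g(u) ∈ L² + Lᵖ'` lies
in `H¹`. -/
theorem IsDistribSolution.exists_memH1With (hp : 1 ≤ p) (hp' : p ≠ ⊤) (hq : 1 ≤ q) (hq' : q ≠ ⊤)
    {g : ℝ → ℝ} {u f₁ f₂ : EuclideanSpace ℝ (Fin N) → ℝ}
    (hu : IsDistribSolution g u) (hu2 : MemLp u 2 volume) (hup : MemLp u p volume)
    (hf₁ : MemLp f₁ 2 volume) (hf₂ : MemLp f₂ q volume) (hf : (fun x => g (u x)) = f₁ + f₂) :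
    ∃ G, MemH1With u G := by
  have h12 : (1 : ℝ≥0∞) ≤ 2 := one_le_two
  have h2t : (2 : ℝ≥0∞) ≠ ⊤ := ENNReal.ofNat_ne_top
  have hsm : ∀ n, ContDiff ℝ ∞ (mollify n u) := fun n => contDiff_mollify n hu.1
  have hΔ : ∀ n x, ∑ i, pd i (pd i (mollify n u)) x = -(mollify n f₁ x + mollify n f₂ x) :=
    fun n x => by
      rw [sum_pd_pd_mollify hu, hf,
        mollify_add n (hf₁.locallyIntegrable h12) (hf₂.locallyIntegrable hq)]
      rfl
  have hpd : ∀ i n, MemLp (pd i (mollify n u)) 2 volume := fun i n => by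
    refine ⟨((hsm n).pd i).continuous.aestronglyMeasurable, ?_⟩
    refine (eLpNorm_pd_le_of_add (p := p) (q := q) (hsm n) (memLp_mollify h12 h2t hu2 n)
      (memLp_mollify hp hp' hup n) (memLp_mollify h12 h2t hf₁ n) (memLp_mollify hq hq' hf₂ n)
      (hΔ n) i).trans_lt ?_
    exact ENNReal.rpow_lt_top_of_nonneg (by norm_num) (ENNReal.add_lt_top.2
      ⟨ENNReal.mul_lt_top (memLp_mollify h12 h2t hu2 n).2 (memLp_mollify h12 h2t hf₁ n).2,
        ENNReal.mul_lt_top (memLp_mollify hp hp' hup n).2 (memLp_mollify hq hq' hf₂ n).2⟩).ne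
  have hlim : Tendsto (fun n : ℕ × ℕ =>
      (eLpNorm (mollify n.1 u - mollify n.2 u) 2 volume *
        eLpNorm (mollify n.1 f₁ - mollify n.2 f₁) 2 volume +
      eLpNorm (mollify n.1 u - mollify n.2 u) p volume *
        eLpNorm (mollify n.1 f₂ - mollify n.2 f₂) q volume) ^ (1 / 2 : ℝ)) atTop (𝓝 0) := by
    have a := ENNReal.Tendsto.mul (tendsto_eLpNorm_mollify_sub_mollify h12 h2t hu2)
      (Or.inr ENNReal.zero_ne_top) (tendsto_eLpNorm_mollify_sub_mollify h12 h2t hf₁)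
      (Or.inr ENNReal.zero_ne_top)
    have b := ENNReal.Tendsto.mul (tendsto_eLpNorm_mollify_sub_mollify hp hp' hup)
      (Or.inr ENNReal.zero_ne_top) (tendsto_eLpNorm_mollify_sub_mollify hq hq' hf₂)
      (Or.inr ENNReal.zero_ne_top)
    have c := (ENNReal.continuous_rpow_const (y := (1 / 2 : ℝ))).tendsto _ |>.comp (a.add b)
    simpa [Function.comp_def] using c
  -- The difference of two mollifications solves the equation with the difference of the right-hand
  -- sides. The energy bound and `hlim` make the partial derivatives Cauchy in `L²`.
  have hex : ∀ i, ∃ F, MemLp F 2 volume ∧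
      Tendsto (fun n => eLpNorm (pd i (mollify n u) - F) 2 volume) atTop (𝓝 0) := fun i => by
    refine exists_memLp_tendsto_eLpNorm_sub h12 (hpd i) ?_
    refine tendsto_of_tendsto_of_tendsto_of_le_of_le tendsto_const_nhds hlim (fun _ => zero_le)
      fun n => ?_
    rw [← pd_sub (hsm _) (hsm _)]
    refine eLpNorm_pd_le_of_add (w := mollify n.1 u - mollify n.2 u)
      (h₁ := mollify n.1 f₁ - mollify n.2 f₁) (h₂ := mollify n.1 f₂ - mollify n.2 f₂)
      ((hsm _).sub (hsm _))
      ((memLp_mollify h12 h2t hu2 _).sub (memLp_mollify h12 h2t hu2 _))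
      ((memLp_mollify hp hp' hup _).sub (memLp_mollify hp hp' hup _))
      ((memLp_mollify h12 h2t hf₁ _).sub (memLp_mollify h12 h2t hf₁ _))
      ((memLp_mollify hq hq' hf₂ _).sub (memLp_mollify hq hq' hf₂ _)) (fun x => ?_) i
    have e : ∀ j, pd j (pd j (mollify n.1 u - mollify n.2 u)) =
        pd j (pd j (mollify n.1 u)) - pd j (pd j (mollify n.2 u)) := fun j => by
      rw [pd_sub (hsm _) (hsm _), pd_sub ((hsm _).pd j) ((hsm _).pd j)]
    simp_rw [e, Pi.sub_apply]
    rw [Finset.sum_sub_distrib, hΔ, hΔ]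
    ring
  choose F hF2 hFlim using hex
  have hG2 : MemLp (fun x => WithLp.toLp 2 fun i => F i x : EuclideanSpace ℝ (Fin N) →
      EuclideanSpace ℝ (Fin N)) 2 volume := by
    have e : (fun x => WithLp.toLp 2 fun i => F i x : EuclideanSpace ℝ (Fin N) →
        EuclideanSpace ℝ (Fin N)) = fun x => ∑ i, F i x • EuclideanSpace.single i (1 : ℝ) := by
      ext x j
      simp [Finset.sum_apply, Pi.single_apply]
    rw [e]
    refine memLp_finsetSum _ fun i _ => ?_
    refine MemLp.of_le_mul (c := 1) (hF2 i) ((hF2 i).1.smul_const _)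
      (Eventually.of_forall fun x => ?_)
    simp [norm_smul]
  refine ⟨_, hu2, hG2, hu.1, hG2.locallyIntegrable h12, fun φ hφ hφc i => ?_⟩
  have hφ2 : MemLp φ 2 volume := hφ.continuous.memLp_of_hasCompactSupport hφc
  have hdφ2 : MemLp (pd i φ) 2 volume :=
    (hφ.pd i).continuous.memLp_of_hasCompactSupport (hφc.pd i)
  have l1 := tendsto_integral_mul_of_tendsto_eLpNorm (fun n => memLp_mollify h12 h2t hu2 n) hu2 hdφ2
    (tendsto_eLpNorm_mollify_sub h12 h2t hu2)
  have l2 := (tendsto_integral_mul_of_tendsto_eLpNorm (hpd i) (hF2 i) hφ2 (hFlim i)).neg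
  -- Integration by parts holds for each smooth mollification, and both sides converge.
  refine tendsto_nhds_unique l1 (l2.congr fun n => ?_)
  rw [integral_mul_pd (hsm n) hφ hφc]

end

/-! ### Sobolev embedding of `H¹`. -/

theorem norm_fderiv_le_sum_abs_pd {N : ℕ} (f : EuclideanSpace ℝ (Fin N) → ℝ)
    (x : EuclideanSpace ℝ (Fin N)) : ‖fderiv ℝ f x‖ ≤ ∑ i, |pd i f x| := by
  refine ContinuousLinearMap.opNorm_le_bound _ (Finset.sum_nonneg fun i _ => abs_nonneg _)
    fun v => ?_
  have hv : v = ∑ i, v i • EuclideanSpace.single i (1 : ℝ) := by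
    simpa using ((EuclideanSpace.basisFun (Fin N) ℝ).sum_repr v).symm
  conv_lhs => rw [hv, map_sum]
  rw [Finset.sum_mul]
  refine (norm_sum_le _ _).trans (Finset.sum_le_sum fun i _ => ?_)
  rw [map_smul, norm_smul, mul_comm]
  exact mul_le_mul_of_nonneg_left (PiLp.norm_apply_le v i) (abs_nonneg _)

theorem eLpNorm_fderiv_le_sum_eLpNorm_pd {N : ℕ} {f : EuclideanSpace ℝ (Fin N) → ℝ}
    (hf : ContDiff ℝ ∞ f) {p : ℝ≥0∞} (hp : 1 ≤ p) :
    eLpNorm (fderiv ℝ f) p volume ≤ ∑ i, eLpNorm (pd i f) p volume := by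
  calc eLpNorm (fderiv ℝ f) p volume ≤ eLpNorm (∑ i, fun x => ‖pd i f x‖) p volume := by
        refine eLpNorm_mono fun x => ?_
        refine (norm_fderiv_le_sum_abs_pd f x).trans ?_
        rw [Finset.sum_apply]
        exact le_abs_self _
    _ ≤ ∑ i, eLpNorm (fun x => ‖pd i f x‖) p volume :=
        eLpNorm_sum_le (fun i _ => (hf.pd i).continuous.norm.aestronglyMeasurable) hp
    _ = _ := by simp only [eLpNorm_norm]

theorem pd_cutoff_mul {N : ℕ} {w : EuclideanSpace ℝ (Fin N) → ℝ} (hw : ContDiff ℝ ∞ w) (n : ℕ)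
    (i : Fin N) : pd i (cutoff N n * w) = cutoff N n * pd i w + w * pd i (cutoff N n) :=
  pd_mul (contDiff_cutoff N n) hw i

/-- `C` depends on neither `n` nor `w`: the bound serves as a majorant for dominated convergence and
keeps the truncations bounded in `H¹`. -/
theorem exists_abs_pd_cutoff_mul_le (N : ℕ) : ∃ C : ℝ, 0 ≤ C ∧
    ∀ {w : EuclideanSpace ℝ (Fin N) → ℝ}, ContDiff ℝ ∞ w → ∀ n i x,
      |pd i (cutoff N n * w) x| ≤ |pd i w x| + C * |w x| := by
  obtain ⟨C, hC0, hC⟩ := exists_abs_pd_cutoff_le N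
  refine ⟨C, hC0, fun {w} hw n i x => ?_⟩
  rw [pd_cutoff_mul hw]
  simp only [Pi.add_apply, Pi.mul_apply]
  refine (abs_add_le _ _).trans ?_
  rw [abs_mul, abs_mul, abs_of_nonneg (cutoff_nonneg N n x), mul_comm |w x|]
  refine add_le_add (mul_le_of_le_one_left (abs_nonneg _) (cutoff_le_one N n x)) ?_
  refine mul_le_mul_of_nonneg_right ((hC n i x).1.trans ?_) (abs_nonneg _)
  refine mul_le_of_le_one_right hC0 ?_
  rw [div_le_one (by positivity)]
  linarith [Nat.cast_nonneg (α := ℝ) n]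

theorem tendsto_pd_cutoff_mul {N : ℕ} {w : EuclideanSpace ℝ (Fin N) → ℝ} (hw : ContDiff ℝ ∞ w)
    (i : Fin N) (x : EuclideanSpace ℝ (Fin N)) :
    Tendsto (fun n => pd i (cutoff N n * w) x) atTop (𝓝 (pd i w x)) := by
  obtain ⟨C, hC0, hC⟩ := exists_abs_pd_cutoff_le N
  have h : Tendsto (fun n => pd i (cutoff N n) x) atTop (𝓝 0) := by
    refine squeeze_zero_norm (fun n => (hC n i x).1) ?_
    simpa using tendsto_one_div_add_atTop_nhds_zero_nat.const_mul C
  simp_rw [pd_cutoff_mul hw]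
  simpa using ((tendsto_cutoff x).mul_const (pd i w x)).add (h.const_mul (w x))

/-- Gagliardo-Nirenberg-Sobolev inequality for smooth functions in `H¹`. -/
theorem exists_eLpNorm_le_mul_sum_eLpNorm_pd {N : ℕ} (hN : 3 ≤ N) :
    ∃ K C : ℝ≥0, ∀ w : EuclideanSpace ℝ (Fin N) → ℝ, ContDiff ℝ ∞ w →
      eLpNorm w (ENNReal.ofReal (2 * (N : ℝ) / ((N : ℝ) - 2))) volume ≤
        K * ∑ i, (eLpNorm (pd i w) 2 volume + C * eLpNorm w 2 volume) := by
  obtain ⟨C, hC0, hC⟩ := exists_abs_pd_cutoff_mul_le N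
  have hN' : (3 : ℝ) ≤ N := by exact_mod_cast hN
  have hN2 : (N : ℝ) - 2 ≠ 0 := by linarith
  have hr0 : 0 ≤ 2 * (N : ℝ) / ((N : ℝ) - 2) := div_nonneg (by positivity) (by linarith)
  refine ⟨eLpNormLESNormFDerivOfEqInnerConst
    (volume : Measure (EuclideanSpace ℝ (Fin N))) (2 : ℝ≥0), C.toNNReal, fun w hw => ?_⟩
  -- The inequality for compactly supported functions applies to each truncation, uniformly in `n`;
  -- lower semicontinuity of the norm gives it for `w`.
  refine Lp.eLpNorm_le_of_ae_tendsto (u := atTop) (f := fun n => cutoff N n * w)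
    (Eventually.of_forall fun n => ?_)
    (fun n => ((contDiff_cutoff N n).continuous.mul hw.continuous).aestronglyMeasurable)
    (Eventually.of_forall fun x => ?_)
  · have hcw : ContDiff ℝ ∞ (cutoff N n * w) := (contDiff_cutoff N n).mul hw
    have hgns := eLpNorm_le_eLpNorm_fderiv_of_eq_inner
      (volume : Measure (EuclideanSpace ℝ (Fin N))) (u := cutoff N n * w) (p := 2)
      (p' := (2 * (N : ℝ) / ((N : ℝ) - 2)).toNNReal) (hcw.of_le (by simp))
      (hasCompactSupport_cutoff N n).mul_right one_le_two
      (by rw [finrank_euclideanSpace_fin]; omega)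
      (by rw [finrank_euclideanSpace_fin, Real.coe_toNNReal _ hr0]; push_cast; field_simp)
    refine hgns.trans ?_
    gcongr
    refine (eLpNorm_fderiv_le_sum_eLpNorm_pd hcw (by norm_num)).trans ?_
    refine Finset.sum_le_sum fun i _ => ?_
    have hCe : (C.toNNReal : ℝ≥0∞) * eLpNorm w 2 volume =
        eLpNorm (fun x => C * |w x|) 2 volume := by
      have := eLpNorm_const_smul C (fun x => ‖w x‖) 2 (volume : Measure (EuclideanSpace ℝ (Fin N)))
      rw [eLpNorm_norm, Real.enorm_of_nonneg hC0] at this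
      exact this.symm
    rw [hCe, ← eLpNorm_norm (pd i w)]
    refine le_trans ?_ (eLpNorm_add_le ((hw.pd i).continuous.norm.aestronglyMeasurable)
      (continuous_const.mul hw.continuous.abs).aestronglyMeasurable one_le_two)
    refine eLpNorm_mono fun x => ?_
    exact (hC hw n i x).trans (le_abs_self _)
  · simpa using (tendsto_cutoff x).mul_const (w x)

theorem MemH1With.memLp_apply {N : ℕ} {v : EuclideanSpace ℝ (Fin N) → ℝ}
    {V : EuclideanSpace ℝ (Fin N) → EuclideanSpace ℝ (Fin N)} (hv : MemH1With v V) (i : Fin N) :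
    MemLp (fun x => V x i) 2 volume := by
  refine MemLp.of_le_mul (c := 1) hv.2.1
    ((EuclideanSpace.proj (𝕜 := ℝ) i).continuous.comp_aestronglyMeasurable hv.2.1.1)
    (Eventually.of_forall fun x => ?_)
  rw [one_mul]
  exact PiLp.norm_apply_le (V x) i

/-- Sobolev embedding of `H¹` into the critical Lebesgue space. -/
theorem MemH1With.memLp_critical {N : ℕ} (hN : 3 ≤ N) {v : EuclideanSpace ℝ (Fin N) → ℝ}
    {V : EuclideanSpace ℝ (Fin N) → EuclideanSpace ℝ (Fin N)} (hv : MemH1With v V) :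
    MemLp v (ENNReal.ofReal (2 * (N : ℝ) / ((N : ℝ) - 2))) volume := by
  have h12 : (1 : ℝ≥0∞) ≤ 2 := one_le_two
  have h2t : (2 : ℝ≥0∞) ≠ ⊤ := ENNReal.ofNat_ne_top
  obtain ⟨K, C, hKC⟩ := exists_eLpNorm_le_mul_sum_eLpNorm_pd hN
  have hvl : LocallyIntegrable v volume := hv.1.locallyIntegrable h12
  refine ⟨hv.1.1, lt_of_le_of_lt (b := (K : ℝ≥0∞) * ∑ i,
    (3 * eLpNorm (fun x => V x i) 2 volume + C * (3 * eLpNorm v 2 volume))) ?_ ?_⟩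
  · refine Lp.eLpNorm_le_of_ae_tendsto (u := atTop) (f := fun n => mollify n v)
      (Eventually.of_forall fun n => (hKC _ (contDiff_mollify n hvl)).trans ?_)
      (fun n => (contDiff_mollify n hvl).continuous.aestronglyMeasurable)
      (ae_tendsto_mollify hvl)
    gcongr with i
    · rw [pd_mollify hv.2.2]
      exact eLpNorm_mollify_le h12 h2t (hv.memLp_apply i) n
    · exact eLpNorm_mollify_le h12 h2t hv.1 n
  · refine ENNReal.mul_lt_top ENNReal.coe_lt_top (ENNReal.sum_lt_top.2 fun i _ => ?_)
    exact ENNReal.add_lt_top.2 ⟨ENNReal.mul_lt_top (by simp) (hv.memLp_apply i).2,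
      ENNReal.mul_lt_top ENNReal.coe_lt_top (ENNReal.mul_lt_top (by simp) hv.1.2)⟩

theorem MemH1With.memLp {N : ℕ} (hN : 3 ≤ N) {p : ℝ} (hp : 2 ≤ p)
    (hp' : p ≤ 2 * (N : ℝ) / ((N : ℝ) - 2)) {v : EuclideanSpace ℝ (Fin N) → ℝ}
    {V : EuclideanSpace ℝ (Fin N) → EuclideanSpace ℝ (Fin N)} (hv : MemH1With v V) :
    MemLp v (ENNReal.ofReal p) volume :=
  (memLp_ofReal_iff_lintegral (by linarith) hv.1.1).2
    (lintegral_ofReal_abs_rpow_lt_top_of_le two_pos hp hp' hv.1.1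
      ((memLp_ofReal_iff_lintegral two_pos hv.1.1).1 (by simpa using hv.1))
      ((memLp_ofReal_iff_lintegral (by linarith) hv.1.1).1 (hv.memLp_critical hN)))

/-! ### Weak formulation. -/

section

variable {N : ℕ} {g : ℝ → ℝ} {u : EuclideanSpace ℝ (Fin N) → ℝ}
  {G : EuclideanSpace ℝ (Fin N) → EuclideanSpace ℝ (Fin N)}

/-- The weak gradient is tested with `pd i φ`, itself a test function, and the sum over `i` is the
Laplacian. -/
theorem sum_integral_mul_pd_eq_of_hasCompactSupport (hu : IsDistribSolution g u)
    (hG : HasWeakGradient u G) {φ : EuclideanSpace ℝ (Fin N) → ℝ} (hφ : ContDiff ℝ ∞ φ)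
    (hφc : HasCompactSupport φ) :
    ∑ i, ∫ x, G x i * pd i φ x = ∫ x, g (u x) * φ x := by
  rw [← hu.2.2 φ hφ hφc]
  simp_rw [laplacian_eq_sum_pd hφ, Finset.mul_sum]
  rw [integral_finsetSum, ← Finset.sum_neg_distrib]
  · refine Finset.sum_congr rfl fun i _ => ?_
    have h := hG.2.2 (pd i φ) (hφ.pd i) (hφc.pd i) i
    rw [← neg_eq_iff_eq_neg] at h
    exact h.symm
  · intro i _
    simpa using hu.1.integrable_smul_right_of_hasCompactSupport ((hφ.pd i).pd i).continuous
      ((hφc.pd i).pd i)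

/-- Compact support of the test function is removed by cutoffs and dominated convergence. -/
theorem sum_integral_mul_pd_eq_of_contDiff (hu : IsDistribSolution g u)
    (hG : MemH1With u G) {w : EuclideanSpace ℝ (Fin N) → ℝ} (hw : ContDiff ℝ ∞ w)
    (hw2 : MemLp w 2 volume) (hpd : ∀ i, MemLp (pd i w) 2 volume)
    (hgw : Integrable (fun x => g (u x) * w x) volume) :
    ∑ i, ∫ x, G x i * pd i w x = ∫ x, g (u x) * w x := by
  obtain ⟨C, hC0, hC⟩ := exists_abs_pd_cutoff_mul_le N
  have hcw : ∀ n, ContDiff ℝ ∞ (cutoff N n * w) := fun n => (contDiff_cutoff N n).mul hw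
  have l1 : ∀ i, Tendsto (fun n => ∫ x, G x i * pd i (cutoff N n * w) x) atTop
      (𝓝 (∫ x, G x i * pd i w x)) := fun i => by
    have hGi := hG.memLp_apply i
    refine tendsto_integral_of_dominated_convergence
      (fun x => |G x i * pd i w x| + C * |G x i * w x|)
      (fun n => hGi.1.mul ((hcw n).pd i).continuous.aestronglyMeasurable)
      ((hGi.integrable_mul (hpd i)).abs.add ((hGi.integrable_mul hw2).abs.const_mul C))
      (fun n => Eventually.of_forall fun x => ?_)
      (Eventually.of_forall fun x => (tendsto_pd_cutoff_mul hw i x).const_mul _)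
    rw [norm_mul, abs_mul, abs_mul]
    calc |G x i| * |pd i (cutoff N n * w) x| ≤ |G x i| * (|pd i w x| + C * |w x|) :=
          mul_le_mul_of_nonneg_left (hC hw n i x) (abs_nonneg _)
      _ = _ := by ring
  have l2 : Tendsto (fun n => ∫ x, g (u x) * (cutoff N n * w) x) atTop
      (𝓝 (∫ x, g (u x) * w x)) := by
    refine tendsto_integral_of_dominated_convergence (fun x => |g (u x) * w x|)
      (fun n => hu.2.1.aestronglyMeasurable.mul (hcw n).continuous.aestronglyMeasurable) hgw.abs
      (fun n => Eventually.of_forall fun x => ?_) (Eventually.of_forall fun x => ?_)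
    · rw [Pi.mul_apply, norm_mul, norm_mul, abs_mul, Real.norm_of_nonneg (cutoff_nonneg N n x)]
      exact mul_le_mul_of_nonneg_left
        (mul_le_of_le_one_left (abs_nonneg _) (cutoff_le_one N n x)) (abs_nonneg _)
    · simpa using ((tendsto_cutoff x).mul_const (w x)).const_mul (g (u x))
  refine tendsto_nhds_unique (tendsto_finsetSum _ fun i _ => l1 i) (l2.congr fun n => ?_)
  exact (sum_integral_mul_pd_eq_of_hasCompactSupport hu hG.2.2 (hcw n)
    (hasCompactSupport_cutoff N n).mul_right).symm

/-- Mollifying `v` reduces to smooth functions: its gradients converge to `V` in `L²`, while the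
mollifications converge to `v` in both `L²` and `L^p`, the spaces dual to the two pieces of `g(u)`.
-/
theorem integral_inner_eq_of_memH1With {p q : ℝ≥0∞} [ENNReal.HolderConjugate p q]
    (hp : 1 ≤ p) (hp' : p ≠ ⊤) {f₁ f₂ : EuclideanSpace ℝ (Fin N) → ℝ}
    (hu : IsDistribSolution g u) (hG : MemH1With u G)
    (hf₁ : MemLp f₁ 2 volume) (hf₂ : MemLp f₂ q volume) (hf : (fun x => g (u x)) = f₁ + f₂)
    {v : EuclideanSpace ℝ (Fin N) → ℝ} {V : EuclideanSpace ℝ (Fin N) → EuclideanSpace ℝ (Fin N)}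
    (hv : MemH1With v V) (hvp : MemLp v p volume) :
    Integrable (fun x => g (u x) * v x) volume ∧
      ∫ x, inner ℝ (G x) (V x) = ∫ x, g (u x) * v x := by
  have h12 : (1 : ℝ≥0∞) ≤ 2 := one_le_two
  have h2t : (2 : ℝ≥0∞) ≠ ⊤ := ENNReal.ofNat_ne_top
  have hsplit : ∀ w : EuclideanSpace ℝ (Fin N) → ℝ,
      (fun x => g (u x) * w x) = (fun x => w x * f₁ x) + fun x => w x * f₂ x := fun w => by
    ext x
    have := congrFun hf x
    simp only [Pi.add_apply] at this ⊢
    rw [this]; ring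
  have i1 : ∀ {w : EuclideanSpace ℝ (Fin N) → ℝ}, MemLp w 2 volume →
      Integrable (fun x => w x * f₁ x) volume := fun h => h.integrable_mul hf₁
  have i2 : ∀ {w : EuclideanSpace ℝ (Fin N) → ℝ}, MemLp w p volume →
      Integrable (fun x => w x * f₂ x) volume := fun h => h.integrable_mul hf₂
  have hint : ∀ {w : EuclideanSpace ℝ (Fin N) → ℝ}, MemLp w 2 volume → MemLp w p volume →
      Integrable (fun x => g (u x) * w x) volume := fun {w} h h' => by
    rw [hsplit]; exact (i1 h).add (i2 h')
  refine ⟨hint hv.1 hvp, ?_⟩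
  have m2 := fun n => memLp_mollify h12 h2t hv.1 n
  have mp := fun n => memLp_mollify hp hp' hvp n
  have mV := fun i n => memLp_mollify h12 h2t (hv.memLp_apply i) n
  have hid : ∀ n, ∑ i, ∫ x, G x i * mollify n (fun y => V y i) x =
      (∫ x, mollify n v x * f₁ x) + ∫ x, mollify n v x * f₂ x := fun n => by
    have h := sum_integral_mul_pd_eq_of_contDiff hu hG
      (contDiff_mollify n (hv.1.locallyIntegrable h12)) (m2 n)
      (fun i => by rw [pd_mollify hv.2.2]; exact mV i n) (hint (m2 n) (mp n))
    simp_rw [pd_mollify hv.2.2] at h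
    rw [h, hsplit]
    exact integral_add (i1 (m2 n)) (i2 (mp n))
  have l1 : Tendsto (fun n => ∑ i, ∫ x, G x i * mollify n (fun y => V y i) x) atTop
      (𝓝 (∑ i, ∫ x, G x i * V x i)) := by
    refine tendsto_finsetSum _ fun i _ => ?_
    simp_rw [mul_comm (G _ i)]
    exact tendsto_integral_mul_of_tendsto_eLpNorm (mV i) (hv.memLp_apply i) (hG.memLp_apply i)
      (tendsto_eLpNorm_mollify_sub h12 h2t (hv.memLp_apply i))
  have l2 := (tendsto_integral_mul_of_tendsto_eLpNorm m2 hv.1 hf₁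
    (tendsto_eLpNorm_mollify_sub h12 h2t hv.1)).add
    (tendsto_integral_mul_of_tendsto_eLpNorm mp hvp hf₂ (tendsto_eLpNorm_mollify_sub hp hp' hvp))
  have heq := tendsto_nhds_unique l1 (l2.congr fun n => (hid n).symm)
  calc ∫ x, inner ℝ (G x) (V x) = ∫ x, ∑ i, G x i * V x i := by
        refine integral_congr_ae (Eventually.of_forall fun x => ?_)
        simp [PiLp.inner_apply, mul_comm]
    _ = ∑ i, ∫ x, G x i * V x i :=
        integral_finsetSum _ fun i _ => (hG.memLp_apply i).integrable_mul (hv.memLp_apply i)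
    _ = (∫ x, v x * f₁ x) + ∫ x, v x * f₂ x := heq
    _ = ∫ x, g (u x) * v x := by
        rw [hsplit]
        exact (integral_add (i1 hv.1) (i2 hvp)).symm

end

end

theorem theorem4p2 (N : ℕ) (hN : 3 ≤ N) (g : ℝ → ℝ) (ℓ p s : ℝ)
    -- (G1)
    (hG1 : Continuous g)
    -- (G2)
    (hℓ : 0 < ℓ)
    (hG2_inf : (⊥ : EReal) < liminf (fun t : ℝ => ((g t / t : ℝ) : EReal)) (𝓝[≠] 0))
    (hG2_sup : limsup (fun t : ℝ => ((g t / t : ℝ) : EReal)) (𝓝[≠] 0) = ((-ℓ : ℝ) : EReal))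
    -- (G3); the limit of `g t * t` may be infinite
    (hp : 2 < p) (hp' : p < 2 * (N : ℝ) / ((N : ℝ) - 2))
    (hG3 : Tendsto (fun t : ℝ => g t / |t| ^ (p - 1)) (cocompact ℝ) (𝓝 0))
    (hG3' : ∃ L : EReal, 0 ≤ L ∧
      Tendsto (fun t : ℝ => ((g t * t : ℝ) : EReal)) (cocompact ℝ) (𝓝 L))
    (hs : 0 < s) (hs' : s < 1) (hps : p < 2 * (N : ℝ) / ((N : ℝ) - 2 * s))
    (u : EuclideanSpace ℝ (Fin N) → ℝ) (hu : MemHs s u) (hsol : IsDistribSolution g u) :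
    MemH1 u ∧ IsWeakSolution g u := by
  have hpq : p.HolderConjugate (p.conjExponent) := Real.HolderConjugate.conjExponent (by linarith)
  have : ENNReal.HolderConjugate (ENNReal.ofReal p) (ENNReal.ofReal p.conjExponent) :=
    hpq.ennrealOfReal
  have h1p : 1 ≤ ENNReal.ofReal p := by
    rw [ENNReal.one_le_ofReal]; linarith
  have h1q : 1 ≤ ENNReal.ofReal p.conjExponent := by
    rw [ENNReal.one_le_ofReal]; exact hpq.symm.lt.le
  obtain ⟨C, -, hgC⟩ := exists_forall_abs_le_mul_abs_add_rpow hG1 hG2_inf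
    (by rw [hG2_sup]; exact_mod_cast neg_neg_of_pos hℓ) hG3
  have hup : MemLp u (ENNReal.ofReal p) volume := hu.memLp hN hs hs' hp.le hps
  obtain ⟨f₁, f₂, hf₁, hf₂, hf⟩ := exists_memLp_add_memLp_comp hG1 hp.le hpq hgC hu.1 hup
  obtain ⟨G, hG⟩ := hsol.exists_memH1With h1p ENNReal.ofReal_ne_top h1q ENNReal.ofReal_ne_top
    hu.1 hup hf₁ hf₂ hf
  -- The bound `p < 2*` enters here, placing the test function `v` in `Lᵖ`; for `u` this came from
  -- the `Hˢ` embedding.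
  exact ⟨⟨G, hG⟩, G, hG, fun v V hv => integral_inner_eq_of_memH1With h1p ENNReal.ofReal_ne_top
    hsol hG hf₁ hf₂ hf hv (hv.memLp hN hp.le hp'.le)⟩
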